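/- **System.** Let $N>1$, $P_s,P_I,N_0,d_1,d_I,d_2,\eta>0$, $0<\theta<1$, $\tau\in\mathbb R$, and put $\rho_1=P_s/N_0$, $\rho_I=P_I/N_0$. Let $\mathbf h_1,\mathbf h_I\in\mathbb C^{N\times1}$ and $\mathbf h_2\in\mathbb C^{1\times N}$ be mutually independent random vectors with i.i.d. $\mathcal{CN}(0,1)$ entries. An energy harvesting relay with $N$ antennas receives $\mathbf y_r=\sqrt{(1-\theta)P_s/d_1^\tau}\,\mathbf h_1x+\sqrt{(1-\theta)P_I/d_I^\tau}\,\mathbf h_Is_I+\mathbf n_r$ (with uncorrelated unit power symbols $x,s_I$ and noise $\mathbf n_r$ of covariance $N_0\mathbf I$) and sends $\mathbf W\mathbf y_r$ to the destination, which receives $\sqrt{1/d_2^\tau}\,\mathbf h_2\mathbf W\mathbf y_r+n_d$ with noise $n_d$ of power $N_0$. In the ZF/MRT scheme $$\mathbf W=\omega\frac{\mathbf h_2^\dagger}{\|\mathbf h_2\|}\mathbf w_1,\qquad \mathbf w_1=\frac{\mathbf h_1^\dagger\mathbf P}{\sqrt{\mathbf h_1^\dagger\mathbf P\mathbf h_1}},\qquad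 \mathbf P=\mathbf I_N-\mathbf h_I(\mathbf h_I^\dagger\mathbf h_I)^{-1}\mathbf h_I^\dagger,$$ where $\omega>0$ is determined, for given channels, by the power constraint $\mathrm E\|\mathbf W\mathbf y_r\|^2=\eta\theta\left(\frac{P_s}{d_1^\tau}\|\mathbf h_1\|^2+\frac{P_I}{d_I^\tau}\|\mathbf h_I\|^2\right)$. Let $\gamma_I$ be the resulting end-to-end signal-to-interference-and-noise ratio at the destination for given channels, let $C=\frac12\mathrm E[\log_2(1+\gamma_I)]$ be the ergodic capacity, and put $$\gamma_{I1}=|\mathbf h_1^\dagger\mathbf P\mathbf h_1|\frac{(1-\theta)\rho_1}{d_1^\tau},\qquad \gamma_{I2}=\frac{\eta\theta}{d_2^\tau}\left(\frac{\rho_1}{d_1^\tau}\|\mathbf h_1\|^2+\frac{\rho_I}{d_I^\tau}\|\mathbf h_I\|^2\right)\|\mathbf h_2\|^2,\qquad C_{\gamma_{Ii}}=\tfrac12\mathrm E[\log_2(1+\gamma_{Ii})].$$ **Theorem.** Suppose $\rho_1/d_1^\tau\neq\rho_I/d_I^\tau$. Then $\log_2(1+\gamma_I)$, $\log_2(1+\gamma_{Ii})$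 and $\ln\gamma_{Ii}$, $i=1,2$, are integrable and $$C\le C_{\gamma_{I1}}+C_{\gamma_{I2}}-\tfrac12\log_2\left(1+e^{\mathrm E(\ln\gamma_{I1})}+e^{\mathrm E(\ln\gamma_{I2})}\right),$$ where, with $\alpha=d_1^\tau/\rho_1$, $\beta=d_I^\tau/\rho_I$, $\kappa=d_2^\tau/(\eta\theta)$, $$C_{\gamma_{I1}}=\frac{e^{\alpha/(1-\theta)}}{2\ln2}\sum_{k=0}^{N-2}\left(\frac{\alpha}{1-\theta}\right)^k\Gamma\left(-k,\frac{\alpha}{1-\theta}\right),\qquad \mathrm E(\ln\gamma_{I1})=\ln((1-\theta)\rho_1)-\ln d_1^\tau+\psi(N-1),$$ $$C_{\gamma_{I2}}=\frac{\alpha^N\beta^N}{2\ln2}\left(\Sigma(\alpha,\beta)+\Sigma(\beta,\alpha)\right),\qquad \mathrm E(\ln\gamma_{I2})=\ln(\eta\theta)-\ln d_2^\tau+\psi(N)+\Lambda(\alpha,\beta)+\Lambda(\beta,\alpha),$$ $$\Sigma(x,y)=\sum_{s=1}^N\frac{\prod_{j=1}^{s-1}(1-N-j)}{(N-s)!\,(s-1)!}(y-x)^{1-N-s}\sum_{m=0}^{N-1}\frac{\kappa^{N+1-s}}{m!}\,G^{3,1}_{1,3}\left(\kappa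 x\,\middle|\,{s-N-1\atop s-N-1,\;m+s-N-1,\;0}\right),$$ $$\Lambda(x,y)=y^N\sum_{s=1}^N\frac{\prod_{j=1}^{s-1}(1-N-j)}{(s-1)!}(y-x)^{1-N-s}x^{s-1}\left(\psi(N-s+1)-\ln x\right).$$ Here $\Gamma(\cdot,\cdot)$ is the upper incomplete gamma function, $\psi$ the digamma function, and $G$ the Meijer $G$-function. -/

import Mathlib

open MeasureTheory ProbabilityTheory Matrix

noncomputable section

namespace Relay

/-! ### Special functions -/

/-- The upper incomplete gamma function `Γ(s, x) = ∫_x^∞ t^(s-1) e^(-t) dt`, for real `s` and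
`x > 0` (the order `s` may be zero or negative). -/
def upperGamma (s x : ℝ) : ℝ :=
  ∫ t in Set.Ioi x, t ^ (s - 1) * Real.exp (-t)

/-- The digamma function at a real argument. -/
def psi (x : ℝ) : ℝ := (Complex.digamma (x : ℂ)).re

/-- The Mellin–Barnes kernel of the Meijer function `G^{m,n}_{p,q}`:
`∏_{j ≤ m} Γ(b_j + s) ∏_{j ≤ n} Γ(1 - a_j - s) / (∏_{j > m} Γ(1 - b_j - s) ∏_{j > n} Γ(a_j + s))`,
where `a` lists `a_1, …, a_n`, `a'` lists `a_{n+1}, …, a_p`, `b` lists `b_1, …, b_m` and `b'` lists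
`b_{m+1}, …, b_q`. -/
def meijerKernel (a a' b b' : List ℝ) (s : ℂ) : ℂ :=
  ((b.map fun x => Complex.Gamma (x + s)).prod * (a.map fun x => Complex.Gamma (1 - x - s)).prod) /
    ((b'.map fun x => Complex.Gamma (1 - x - s)).prod * (a'.map fun x => Complex.Gamma (x + s)).prod)

/-- A vertical line `Re s = σ` separates the poles of the `Γ(b_j + s)`, `j ≤ m` (to its left) from
the poles of the `Γ(1 - a_j - s)`, `j ≤ n` (to its right). -/
def Separates (a b : List ℝ) (σ : ℝ) : Prop :=
  (∀ x ∈ b, -x < σ) ∧ ∀ x ∈ a, σ < 1 - x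

open Classical in
/-- The Meijer function `G^{m,n}_{p,q}(z | a_1, …, a_p; b_1, …, b_q)` with real parameters at a real
`z > 0`, as the Mellin–Barnes integral `(1/2πi) ∫ kernel(s) z^(-s) ds` along a vertical line that
separates the two families of poles (all such lines give the same value). The value `0` is a
placeholder for the parameters for which no vertical line separates the poles. -/
def meijerG (a a' b b' : List ℝ) (z : ℝ) : ℂ :=
  if h : ∃ σ, Separates a b σ then mellinInv h.choose (meijerKernel a a' b b') z else 0

/-! ### Rayleigh fading channels -/

/-- The circularly symmetric complex Gaussian law `CN(0,1)`: real and imaginary parts are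
independent centred Gaussians of variance `1/2`. -/
def stdComplexGaussian : Measure ℂ :=
  ((gaussianReal 0 (1 / 2)).prod (gaussianReal 0 (1 / 2))).map fun p => Complex.mk p.1 p.2

/-- The source-relay channel `h₁`, the interferer-relay channel `h_I` and the relay-destination
channel `h₂` are mutually independent, and each has i.i.d. `CN(0,1)` entries. -/
structure IsRayleigh {Ω : Type*} [MeasurableSpace Ω] (μ : Measure Ω) {N : ℕ}
    (h₁ hI h₂ : Ω → Fin N → ℂ) : Prop where
  law₁ : ∀ i, HasLaw (fun ω => h₁ ω i) stdComplexGaussian μ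
  lawI : ∀ i, HasLaw (fun ω => hI ω i) stdComplexGaussian μ
  law₂ : ∀ i, HasLaw (fun ω => h₂ ω i) stdComplexGaussian μ
  indep : iIndepFun (Sum.elim (fun i ω => h₁ ω i)
    (Sum.elim (fun i ω => hI ω i) (fun i ω => h₂ ω i)) : Fin N ⊕ Fin N ⊕ Fin N → Ω → ℂ) μ

/-- The squared Euclidean norm of a complex vector. -/
def normSq {N : ℕ} (v : Fin N → ℂ) : ℝ := ∑ i, ‖v i‖ ^ 2

/-! ### The energy harvesting relay with co-channel interference -/

/-- The parameters of the system: source power, interferer power, noise power, the three distances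
(source-relay, interferer-relay, relay-destination), path loss exponent, energy conversion
efficiency and power splitting ratio. -/
structure Params where
  Ps : ℝ
  PI : ℝ
  N₀ : ℝ
  d₁ : ℝ
  dI : ℝ
  d₂ : ℝ
  τ : ℝ
  η : ℝ
  θ : ℝ

namespace Params

variable (S : Params)

/-- Admissible parameters. -/
structure Valid : Prop where
  Ps_pos : 0 < S.Ps
  PI_pos : 0 < S.PI
  N₀_pos : 0 < S.N₀
  d₁_pos : 0 < S.d₁
  dI_pos : 0 < S.dI
  d₂_pos : 0 < S.d₂
  η_pos : 0 < S.η
  θ_pos : 0 < S.θ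
  θ_lt_one : S.θ < 1

/-- `ρ₁ = P_s / N₀`. -/
def ρ₁ : ℝ := S.Ps / S.N₀

/-- `ρ_I = P_I / N₀`. -/
def ρI : ℝ := S.PI / S.N₀

variable {N : ℕ} (h₁ hI h₂ : Fin N → ℂ)

/-- The relay power `P_r`: the energy harvested in the first phase of duration `T/2`, divided by
the duration `T/2` of the second phase. -/
def relayPower : ℝ :=
  S.η * S.θ * (S.Ps / S.d₁ ^ S.τ * normSq h₁ + S.PI / S.dI ^ S.τ * normSq hI)

/-- The transmit power `E‖W y_r‖²` for given channels, where
`y_r = √((1-θ)P_s/d₁^τ) h₁ x + √((1-θ)P_I/d_I^τ) h_I s_I + n_r`, with unit power symbols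
`x`, `s_I` and noise of covariance `N₀ I`, all uncorrelated. -/
def transmitPower (W : Matrix (Fin N) (Fin N) ℂ) : ℝ :=
  (1 - S.θ) * S.Ps / S.d₁ ^ S.τ * normSq (W *ᵥ h₁)
    + (1 - S.θ) * S.PI / S.dI ^ S.τ * normSq (W *ᵥ hI)
    + S.N₀ * ∑ i, ∑ j, ‖W i j‖ ^ 2

/-- The end-to-end signal-to-interference-and-noise ratio at the destination, which receives
`y_d = √(1/d₂^τ) h₂ W y_r + n_d`, with `n_d` of power `N₀`. -/
def sinr (W : Matrix (Fin N) (Fin N) ℂ) : ℝ :=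
  ((1 - S.θ) * S.Ps / (S.d₁ ^ S.τ * S.d₂ ^ S.τ) * ‖h₂ ⬝ᵥ (W *ᵥ h₁)‖ ^ 2) /
    ((1 - S.θ) * S.PI / (S.dI ^ S.τ * S.d₂ ^ S.τ) * ‖h₂ ⬝ᵥ (W *ᵥ hI)‖ ^ 2
      + normSq (h₂ ᵥ* W) / S.d₂ ^ S.τ * S.N₀ + S.N₀)

end Params

variable {N : ℕ}

/-- The projection `P = I - h_I (h_I† h_I)⁻¹ h_I†`. -/
def zfProj (hI : Fin N → ℂ) : Matrix (Fin N) (Fin N) ℂ :=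
  1 - (star hI ⬝ᵥ hI)⁻¹ • vecMulVec hI (star hI)

/-- `|h₁† P h₁|`. -/
def zfGain (h₁ hI : Fin N → ℂ) : ℝ := ‖star h₁ ⬝ᵥ (zfProj hI *ᵥ h₁)‖

/-- The zero-forcing combining row vector `w₁ = h₁† P / √(h₁† P h₁)`. -/
def zfCombiner (h₁ hI : Fin N → ℂ) : Fin N → ℂ :=
  ((Real.sqrt (zfGain h₁ hI) : ℂ)⁻¹) • (star h₁ ᵥ* zfProj hI)

/-- The relay matrix of the ZF/MRT scheme before power scaling, `(h₂† / ‖h₂‖) w₁`. -/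
def zfDirection (h₁ hI h₂ : Fin N → ℂ) : Matrix (Fin N) (Fin N) ℂ :=
  ((Real.sqrt (normSq h₂) : ℂ)⁻¹) • vecMulVec (star h₂) (zfCombiner h₁ hI)

namespace Params

variable (S : Params)

/-- The power constraint factor `ω`, determined by `E‖W y_r‖² = P_r`. -/
def zfScale (h₁ hI h₂ : Fin N → ℂ) : ℝ :=
  Real.sqrt (S.relayPower h₁ hI / S.transmitPower h₁ hI (zfDirection h₁ hI h₂))

/-- The relay matrix of the ZF/MRT scheme, `W = ω (h₂† / ‖h₂‖) w₁`. -/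
def zfMatrix (h₁ hI h₂ : Fin N → ℂ) : Matrix (Fin N) (Fin N) ℂ :=
  (S.zfScale h₁ hI h₂ : ℂ) • zfDirection h₁ hI h₂

/-- The end-to-end SINR `γ_I` of the ZF/MRT scheme. -/
def gammaZF (h₁ hI h₂ : Fin N → ℂ) : ℝ := S.sinr h₁ hI h₂ (S.zfMatrix h₁ hI h₂)

/-- The first-hop SINR `γ_{I1}` of the ZF/MRT scheme. -/
def gammaZF₁ (h₁ hI : Fin N → ℂ) : ℝ := zfGain h₁ hI * ((1 - S.θ) * S.ρ₁ / S.d₁ ^ S.τ)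

/-- The second-hop SNR `γ_{I2}`, which is the same for the ZF/MRT and the MRC/MRT scheme. -/
def gamma₂ (h₁ hI h₂ : Fin N → ℂ) : ℝ :=
  S.η * S.θ / S.d₂ ^ S.τ *
    (S.ρ₁ / S.d₁ ^ S.τ * normSq h₁ + S.ρI / S.dI ^ S.τ * normSq hI) * normSq h₂

/-! ### The closed forms -/

variable (N)

/-- The closed form of `C_{γ_{I1}}` for the ZF/MRT scheme. -/
def capFormula₁ : ℝ :=
  Real.exp (S.d₁ ^ S.τ / ((1 - S.θ) * S.ρ₁)) / (2 * Real.log 2) *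
    ∑ k ∈ Finset.range (N - 1), (S.d₁ ^ S.τ / ((1 - S.θ) * S.ρ₁)) ^ k *
      upperGamma (-(k : ℝ)) (S.d₁ ^ S.τ / ((1 - S.θ) * S.ρ₁))

/-- The closed form of `E ln γ_{I1}` for the ZF/MRT scheme. -/
def logFormula₁ : ℝ :=
  Real.log ((1 - S.θ) * S.ρ₁) - Real.log (S.d₁ ^ S.τ) + psi ((N : ℝ) - 1)

/-- One of the two sums over `s` in the closed form of `C_{γ_{I2}}`, with `x = d^τ/ρ` for the link
in the argument of the Meijer function, and `y = d^τ/ρ` for the other link. -/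
def capSum₂ (x y : ℝ) : ℂ :=
  ∑ s ∈ Finset.Icc 1 N,
    (((∏ j ∈ Finset.Icc 1 (s - 1), (1 - (N : ℝ) - j)) /
        ((N - s).factorial * (s - 1).factorial) *
        (y - x) ^ (1 - (N : ℤ) - s) : ℝ) : ℂ) *
      ∑ m ∈ Finset.range N,
        ((1 / (m.factorial : ℝ) * (S.d₂ ^ S.τ / (S.η * S.θ)) ^ (N + 1 - s) : ℝ) : ℂ) *
          meijerG [(s : ℝ) - N - 1] [] [(s : ℝ) - N - 1, (m : ℝ) + s - N - 1, 0] []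
            (x * S.d₂ ^ S.τ / (S.η * S.θ))

/-- The closed form of `C_{γ_{I2}}`. -/
def capFormula₂ : ℂ :=
  (((S.d₁ ^ S.τ) ^ N * (S.dI ^ S.τ) ^ N / (S.ρ₁ ^ N * S.ρI ^ N * (2 * Real.log 2)) : ℝ) : ℂ) *
    (S.capSum₂ N (S.d₁ ^ S.τ / S.ρ₁) (S.dI ^ S.τ / S.ρI)
      + S.capSum₂ N (S.dI ^ S.τ / S.ρI) (S.d₁ ^ S.τ / S.ρ₁))

/-- One of the two sums over `s` in the closed form of `E ln γ_{I2}`, for links with `d^τ/ρ = x`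
and `d^τ/ρ = y` (so that `-ln x = ln ρ - ln d^τ` for the first link). -/
def logSum₂ (x y : ℝ) : ℝ :=
  y ^ N * ∑ s ∈ Finset.Icc 1 N,
    (∏ j ∈ Finset.Icc 1 (s - 1), (1 - (N : ℝ) - j)) / (s - 1).factorial *
      (y - x) ^ (1 - (N : ℤ) - s) * (x⁻¹) ^ (1 - (s : ℤ)) *
      (psi ((N : ℝ) - s + 1) - Real.log x)

/-- The closed form of `E ln γ_{I2}`. -/
def logFormula₂ : ℝ :=
  Real.log (S.η * S.θ) - Real.log (S.d₂ ^ S.τ) + psi N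
    + logSum₂ N (S.d₁ ^ S.τ / S.ρ₁) (S.dI ^ S.τ / S.ρI)
    + logSum₂ N (S.dI ^ S.τ / S.ρI) (S.d₁ ^ S.τ / S.ρ₁)

/-- The upper bound `C_up` of the ergodic capacity. -/
def capUpperBound : ℝ :=
  S.capFormula₁ N + (S.capFormula₂ N).re
    - 1 / 2 * Real.logb 2 (1 + Real.exp (S.logFormula₁ N) + Real.exp (S.logFormula₂ N))

end Params

/-- The ergodic capacity `(1/2) E[log₂(1 + γ)]` of a two-phase transmission with random signal to
noise ratio `γ`. -/
def ergodicCapacity {Ω : Type*} [MeasurableSpace Ω] (μ : Measure Ω) (γ : Ω → ℝ) : ℝ :=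
  1 / 2 * ∫ ω, Real.logb 2 (1 + γ ω) ∂μ

end Relay

end

/-! Zero forcing removes the interferer exactly: `P` annihilates `hI` and the combiner is a unit
vector. With the power constraint inserted, the end-to-end ratio is therefore `γ = γ₁ γ₂ / (1 + γ₁ +
γ₂)`, so `1 + γ = (1 + γ₁)(1 + γ₂) / (1 + γ₁ + γ₂)` and the capacity splits into three logarithmic
expectations. The function `log (1 + exp u + exp v)` is convex, so Jensen's inequality at `(log γ₁,
log γ₂)` bounds the third one from below (`log_one_add_exp_integral_le`). The two hops share `h₁`,
but Jensen needs no independence between them.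

For the closed forms, squared norms of complex Gaussian vectors have gamma laws. By unitary
invariance the gain left after projecting off `hI` is a squared norm in dimension `N - 1`, whatever
`hI` is, hence of gamma law with shape `N - 1` (`map_zfGain_prod`). Integration by parts and the
Laplace representation of `(a + x)⁻¹` give the incomplete gamma functions; the derivative of the
gamma integral gives digamma.

The second hop is `c A X` with `X` of gamma law and `A` an independent sum of two gamma variables of
distinct rates. Partial fractions of the characteristic function of `A` turn expectations over `A`
into finite combinations of integrals against `t ^ j * exp (-x t)` (`integral_erlang_conv_erlang`).
For `log (1 + c A X)` these integrals are Laplace transforms of `t ^ n * E (1 + t X)⁻¹`. Repeated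
Mellin convolution computes their Mellin transforms as products of four gamma functions, which are
the Meijer kernels up to `m!`, and Mellin inversion concludes (`meijerG_eq_laplaceInvGamma`). -/

noncomputable section

namespace Relay

open Set Filter Topology

/-! ### Integrals of gamma densities -/

/-- The function `t ^ k / k! * exp (-r t)`, whose Laplace transform is `(r + s) ^ (-(k + 1))`. -/
def erl (k : ℕ) (r t : ℝ) : ℝ := t ^ k / k.factorial * Real.exp (-(r * t))

lemma continuous_erl (k : ℕ) (r : ℝ) : Continuous (erl k r) := by
  unfold erl; fun_prop

lemma erl_nonneg (k : ℕ) (r : ℝ) {t : ℝ} (ht : 0 ≤ t) : 0 ≤ erl k r t := by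
  unfold erl; positivity

lemma integrableOn_pow_mul_exp_neg (k : ℕ) {r : ℝ} (hr : 0 < r) :
    IntegrableOn (fun t : ℝ => t ^ k * Real.exp (-(r * t))) (Ioi 0) := by
  have h := integrableOn_rpow_mul_exp_neg_mul_rpow (s := k) (p := 1) (b := r)
    (by have := k.cast_nonneg (α := ℝ); linarith) one_pos hr
  simpa using h

lemma integrableOn_erl (k : ℕ) {r : ℝ} (hr : 0 < r) : IntegrableOn (erl k r) (Ioi 0) := by
  refine ((integrableOn_pow_mul_exp_neg k hr).const_mul (k.factorial : ℝ)⁻¹).congr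
    (ae_of_all _ fun t => ?_)
  simp only [erl]; ring

lemma integrableOn_cpow_mul_cexp_neg (k : ℕ) {c : ℂ} (hc : 0 < c.re) :
    IntegrableOn (fun t : ℝ => (t : ℂ) ^ k * Complex.exp (-(c * t))) (Ioi 0) := by
  refine (integrable_norm_iff (by fun_prop)).1 ?_
  refine (integrableOn_pow_mul_exp_neg k hc).congr ?_
  filter_upwards [ae_restrict_mem measurableSet_Ioi] with t (ht : 0 < t)
  simp [Complex.norm_exp, abs_of_pos ht]

lemma tendsto_pow_mul_exp_neg (k : ℕ) {r : ℝ} (hr : 0 < r) :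
    Tendsto (fun t : ℝ => t ^ k * Real.exp (-(r * t))) atTop (𝓝 0) := by
  simpa [Function.comp_def] using
    tendsto_rpow_mul_exp_neg_mul_atTop_nhds_zero (k : ℝ) r hr

lemma tendsto_cpow_mul_cexp_neg (k : ℕ) {c : ℂ} (hc : 0 < c.re) :
    Tendsto (fun t : ℝ => (t : ℂ) ^ k * Complex.exp (-(c * t))) atTop (𝓝 0) := by
  rw [tendsto_zero_iff_norm_tendsto_zero]
  refine (tendsto_pow_mul_exp_neg k hc).congr' ?_
  filter_upwards [eventually_gt_atTop 0] with t ht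
  simp [Complex.norm_exp, abs_of_pos ht]

/-- Integration by parts lowers `k`. The rate is complex because `c = r - t * I` yields the
characteristic function of a gamma law. -/
lemma integral_cpow_mul_cexp_neg (k : ℕ) {c : ℂ} (hc : 0 < c.re) :
    ∫ t in Ioi (0 : ℝ), (t : ℂ) ^ k * Complex.exp (-(c * t)) = k.factorial / c ^ (k + 1) := by
  have hc0 : c ≠ 0 := by rintro rfl; simp at hc
  have hexp : ∀ x : ℝ, HasDerivAt (fun t : ℝ => Complex.exp (-(c * t)))
      (-c * Complex.exp (-(c * x))) x := fun x => by
    have h : HasDerivAt (fun t : ℝ => -(c * (t : ℂ))) (-c) x := by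
      simpa using ((Complex.ofRealCLM.hasDerivAt (x := x)).const_mul c).fun_neg
    simpa [mul_comm] using h.cexp
  induction k with
  | zero =>
    have hd : ∀ x ∈ Ici (0 : ℝ), HasDerivAt (fun t : ℝ => -Complex.exp (-(c * t)) / c)
        ((x : ℂ) ^ 0 * Complex.exp (-(c * x))) x := fun x _ => by
      refine ((hexp x).fun_neg.div_const c).congr_deriv ?_
      field_simp
    have h0 : Tendsto (fun t : ℝ => -Complex.exp (-(c * t)) / c) atTop (𝓝 0) := by
      simpa using ((tendsto_cpow_mul_cexp_neg 0 hc).neg).div_const c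
    rw [integral_Ioi_of_hasDerivAt_of_tendsto' hd (integrableOn_cpow_mul_cexp_neg 0 hc) h0]
    simp [neg_div]
  | succ k ih =>
    have hd : ∀ x ∈ Ici (0 : ℝ),
        HasDerivAt (fun t : ℝ => -((t : ℂ) ^ (k + 1) * Complex.exp (-(c * t))) / c)
        ((x : ℂ) ^ (k + 1) * Complex.exp (-(c * x))
          - (k + 1) / c * ((x : ℂ) ^ k * Complex.exp (-(c * x)))) x := fun x _ => by
      have hp : HasDerivAt (fun t : ℝ => (t : ℂ) ^ (k + 1)) ((k + 1 : ℕ) * (x : ℂ) ^ k * 1) x := by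
        simpa using (Complex.ofRealCLM.hasDerivAt (x := x)).fun_pow (k + 1)
      refine ((hp.fun_mul (hexp x)).fun_neg.div_const c).congr_deriv ?_
      push_cast
      field_simp
      ring
    have h0 : Tendsto (fun t : ℝ => -((t : ℂ) ^ (k + 1) * Complex.exp (-(c * t))) / c)
        atTop (𝓝 0) := by
      simpa using ((tendsto_cpow_mul_cexp_neg (k + 1) hc).neg).div_const c
    have hi := (integrableOn_cpow_mul_cexp_neg k hc).const_mul ((k + 1 : ℂ) / c)
    have hi' := integrableOn_cpow_mul_cexp_neg (k + 1) hc
    have h := integral_Ioi_of_hasDerivAt_of_tendsto' hd (hi'.sub hi) h0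
    rw [integral_sub hi' hi, integral_const_mul, ih] at h
    simp only [Complex.ofReal_zero, ne_eq, Nat.add_eq_zero_iff, one_ne_zero, and_false,
      not_false_eq_true, zero_pow, zero_mul, neg_zero, zero_div, sub_zero] at h
    rw [sub_eq_zero.1 h, Nat.factorial_succ]
    push_cast
    field_simp
    ring

lemma integral_erl (k : ℕ) {r : ℝ} (hr : 0 < r) :
    ∫ t in Ioi (0 : ℝ), erl k r t = (r ^ (k + 1))⁻¹ := by
  have h := integral_cpow_mul_cexp_neg k (c := r) (by simpa using hr)
  have h2 : ∫ t in Ioi (0 : ℝ), t ^ k * Real.exp (-(r * t)) = k.factorial / r ^ (k + 1) := by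
    rw [← Complex.ofReal_inj, ← integral_complex_ofReal]
    push_cast
    exact_mod_cast h
  have h3 : ∀ t, erl k r t = (k.factorial : ℝ)⁻¹ * (t ^ k * Real.exp (-(r * t))) := fun t => by
    simp only [erl]; ring
  simp_rw [h3]
  rw [integral_const_mul, h2]
  field_simp

lemma id_mul_erl (k : ℕ) (r t : ℝ) : t * erl k r t = (k + 1) * erl (k + 1) r t := by
  simp only [erl, Nat.factorial_succ]
  push_cast
  field_simp
  ring

lemma erl_mul_left (k : ℕ) {r c : ℝ} (t : ℝ) :
    erl k r (c * t) = c ^ k * erl k (r * c) t := by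
  simp only [erl, mul_pow]
  rw [mul_assoc r c t]; ring

/-- The derivatives telescope. The sum is the tail probability of the gamma law of shape `n + 1`,
hence an antiderivative of minus its density. -/
lemma hasDerivAt_sum_erl (n : ℕ) (x : ℝ) :
    HasDerivAt (fun t => ∑ k ∈ Finset.range (n + 1), erl k 1 t) (-erl n 1 x) x := by
  have hexp : HasDerivAt (fun t : ℝ => Real.exp (-(1 * t))) (-Real.exp (-(1 * x))) x := by
    have h : HasDerivAt (fun t : ℝ => -(1 * t)) (-1) x := by
      simpa using (hasDerivAt_id' x).fun_neg
    simpa using h.exp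
  induction n with
  | zero =>
    simp only [zero_add, Finset.range_one, Finset.sum_singleton, erl, pow_zero, Nat.factorial_zero,
      Nat.cast_one, div_one, one_mul] at hexp ⊢
    exact hexp
  | succ n ih =>
    have h := ih.fun_add (((hasDerivAt_pow (n + 1) x).div_const ((n + 1).factorial : ℝ)).fun_mul hexp)
    refine (h.congr_deriv ?_).congr_of_eventuallyEq
      (Eventually.of_forall fun t => Finset.sum_range_succ (fun k => erl k 1 t) (n + 1))
    simp only [erl, Nat.factorial_succ]
    push_cast
    field_simp
    simp

/-! ### Expectations of `log (1 + c X)` for gamma `X`, and the incomplete gamma function -/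

lemma log_one_add_mul_nonneg {c x : ℝ} (hc : 0 ≤ c) (hx : 0 ≤ x) : 0 ≤ Real.log (1 + c * x) :=
  Real.log_nonneg (by nlinarith [mul_nonneg hc hx])

lemma log_one_add_mul_le {c x : ℝ} (hc : 0 ≤ c) (hx : 0 ≤ x) : Real.log (1 + c * x) ≤ c * x := by
  have := Real.log_le_sub_one_of_pos (show 0 < 1 + c * x by nlinarith [mul_nonneg hc hx])
  linarith

lemma integrableOn_log_one_add_mul_erl (n : ℕ) {c r : ℝ} (hc : 0 ≤ c) (hr : 0 < r) :
    IntegrableOn (fun x => Real.log (1 + c * x) * erl n r x) (Ioi 0) := by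
  refine ((integrableOn_erl (n + 1) hr).const_mul (c * (n + 1))).mono'
    (by have := (continuous_erl n r).measurable; fun_prop) ?_
  filter_upwards [ae_restrict_mem measurableSet_Ioi] with x (hx : 0 < x)
  rw [Real.norm_of_nonneg (mul_nonneg (log_one_add_mul_nonneg hc hx.le) (erl_nonneg n r hx.le)),
    mul_assoc, ← id_mul_erl, ← mul_assoc]
  exact mul_le_mul_of_nonneg_right (log_one_add_mul_le hc hx.le) (erl_nonneg n r hx.le)

lemma integrableOn_div_one_add_mul_erl (n : ℕ) {c r : ℝ} (hc : 0 ≤ c) (hr : 0 < r) :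
    IntegrableOn (fun x => c / (1 + c * x) * erl n r x) (Ioi 0) := by
  refine ((integrableOn_erl n hr).const_mul c).mono'
    (by have := (continuous_erl n r).measurable; fun_prop) ?_
  filter_upwards [ae_restrict_mem measurableSet_Ioi] with x (hx : 0 < x)
  have h1 := mul_nonneg hc hx.le
  rw [Real.norm_of_nonneg (mul_nonneg (by positivity) (erl_nonneg n r hx.le))]
  exact mul_le_mul_of_nonneg_right (div_le_self hc (by linarith)) (erl_nonneg n r hx.le)

/-- Integration by parts against the tail `∑_{k ≤ n} x ^ k / k! * exp (-x)` of the gamma law. -/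
lemma integral_log_one_add_mul_erl (n : ℕ) {c : ℝ} (hc : 0 ≤ c) :
    ∫ x in Ioi (0 : ℝ), Real.log (1 + c * x) * erl n 1 x =
      ∑ k ∈ Finset.range (n + 1), ∫ x in Ioi (0 : ℝ), c / (1 + c * x) * erl k 1 x := by
  have hd : ∀ x ∈ Ici (0 : ℝ),
      HasDerivAt (fun t => -(Real.log (1 + c * t) * ∑ k ∈ Finset.range (n + 1), erl k 1 t))
        (Real.log (1 + c * x) * erl n 1 x
          - ∑ k ∈ Finset.range (n + 1), c / (1 + c * x) * erl k 1 x) x := fun x hx => by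
    have h1 := mul_nonneg hc hx
    have hl : HasDerivAt (fun t => Real.log (1 + c * t)) (c / (1 + c * x)) x := by
      have h : HasDerivAt (fun t => 1 + c * t) c x := by
        simpa using ((hasDerivAt_id' x).const_mul c).const_add 1
      exact h.log (by linarith)
    refine (hl.fun_mul (hasDerivAt_sum_erl n x)).fun_neg.congr_deriv ?_
    rw [← Finset.mul_sum]
    ring
  have h0 : Tendsto (fun t => -(Real.log (1 + c * t) * ∑ k ∈ Finset.range (n + 1), erl k 1 t))
      atTop (𝓝 0) := by
    -- The bound `log (1 + c t) ≤ c t` reduces the boundary term at infinity to a polynomial times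
    -- `exp (-t)`.
    have hT : Tendsto (fun t => c * ∑ k ∈ Finset.range (n + 1), (t * erl k 1 t)) atTop (𝓝 0) := by
      rw [show (0 : ℝ) = c * ∑ k ∈ Finset.range (n + 1), 0 by simp]
      refine (tendsto_finsetSum _ fun k _ => ?_).const_mul c
      have := (tendsto_pow_mul_exp_neg (k + 1) one_pos).const_mul ((k.factorial : ℝ)⁻¹)
      rw [mul_zero] at this
      refine this.congr fun t => ?_
      simp only [erl]; ring
    have := squeeze_zero' (f := fun t => Real.log (1 + c * t) *
      ∑ k ∈ Finset.range (n + 1), erl k 1 t) ?_ ?_ hT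
    · simpa using this.neg
    · filter_upwards [eventually_ge_atTop 0] with t ht
      exact mul_nonneg (log_one_add_mul_nonneg hc ht)
        (Finset.sum_nonneg fun k _ => erl_nonneg k 1 ht)
    · filter_upwards [eventually_ge_atTop 0] with t ht
      rw [← Finset.mul_sum, ← mul_assoc]
      exact mul_le_mul_of_nonneg_right (log_one_add_mul_le hc ht)
        (Finset.sum_nonneg fun k _ => erl_nonneg k 1 ht)
  have hi := integrableOn_log_one_add_mul_erl n hc one_pos
  have hi' : ∀ k ∈ Finset.range (n + 1), IntegrableOn
    (fun x => c / (1 + c * x) * erl k 1 x) (Ioi 0) := fun k _ =>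
    integrableOn_div_one_add_mul_erl k hc one_pos
  have h := integral_Ioi_of_hasDerivAt_of_tendsto' hd (hi.sub (integrable_finsetSum _ hi')) h0
  rw [integral_sub hi (integrable_finsetSum _ hi'), integral_finsetSum _ hi'] at h
  simpa [sub_eq_zero] using h

/-- Substitute `t = a * (1 + w)`: the power of `1 + w` contributes `a ^ (n + 1)`, and `dw = dt / a`
takes one factor back. -/
lemma integral_exp_neg_mul_Ioi_one_add (n : ℕ) {a : ℝ} (ha : 0 < a) :
    ∫ w in Ioi (0 : ℝ), Real.exp (-(a * w)) * ((1 + w) ^ (n + 1))⁻¹ =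
      a ^ n * Real.exp a * upperGamma (-(n : ℝ)) a := by
  have h1 : ∫ w in Ioi (0 : ℝ), Real.exp (-(a * w)) * ((1 + w) ^ (n + 1))⁻¹ =
      ∫ w in Ioi (0 : ℝ), (fun t : ℝ => a ^ (n + 1) * Real.exp a *
        (t ^ (-(n : ℝ) - 1) * Real.exp (-t))) (a * w + a) := by
    refine setIntegral_congr_fun measurableSet_Ioi fun w (hw : 0 < w) => ?_
    have h2 : (a * w + a) ^ (-(n : ℝ) - 1) = ((a * (1 + w)) ^ (n + 1))⁻¹ := by
      rw [show -(n : ℝ) - 1 = -((n + 1 : ℕ) : ℝ) by push_cast; ring, Real.rpow_neg (by positivity),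
        Real.rpow_natCast]
      ring_nf
    simp only [h2]
    rw [show -(a * w + a) = -(a * w) + -a by ring, Real.exp_add, mul_pow, Real.exp_neg a]
    field_simp
  have h3 := integral_comp_mul_left_Ioi (fun s : ℝ => (fun t : ℝ => a ^ (n + 1) * Real.exp a *
        (t ^ (-(n : ℝ) - 1) * Real.exp (-t))) (s + a)) 0 ha
  have h4 := (measurePreserving_add_right volume a).setIntegral_preimage_emb
    (measurableEmbedding_addRight a) (fun t : ℝ => a ^ (n + 1) * Real.exp a *
        (t ^ (-(n : ℝ) - 1) * Real.exp (-t))) (Ioi a)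
  rw [preimage_add_const_Ioi, sub_self] at h4
  rw [h1, h3, mul_zero, h4, integral_const_mul, upperGamma, smul_eq_mul]
  field_simp
  ring

/-- Write `(a + x)⁻¹` as the integral of `exp (-((a + x) * w))` over `w > 0` and exchange the
integrals; the inner integral over `x` is the Laplace transform `(1 + w) ^ (-(n + 1))`. -/
lemma integral_inv_add_mul_erl (n : ℕ) {a : ℝ} (ha : 0 < a) :
    ∫ x in Ioi (0 : ℝ), (a + x)⁻¹ * erl n 1 x =
      a ^ n * Real.exp a * upperGamma (-(n : ℝ)) a := by
  rw [← integral_exp_neg_mul_Ioi_one_add n ha]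
  have hin : ∀ x : ℝ, 0 < x → ∫ w in Ioi (0 : ℝ), Real.exp (-((a + x) * w)) = (a + x)⁻¹ :=
    fun x hx => by
    have := integral_erl 0 (r := a + x) (by linarith)
    simpa [erl] using this
  have hint : Integrable (Function.uncurry fun x w : ℝ => erl n 1 x * Real.exp (-((a + x) * w)))
      ((volume.restrict (Ioi 0)).prod (volume.restrict (Ioi 0))) := by
    rw [integrable_prod_iff]
    · constructor
      · filter_upwards [ae_restrict_mem measurableSet_Ioi] with x (hx : 0 < x)
        simp only [Function.uncurry_apply_pair]
        refine Integrable.const_mul ?_ _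
        simpa [IntegrableOn] using integrableOn_pow_mul_exp_neg 0 (r := a + x) (by linarith)
      · refine ((integrableOn_erl n one_pos).const_mul a⁻¹).mono' ?_ ?_
        · refine StronglyMeasurable.aestronglyMeasurable ?_
          refine StronglyMeasurable.integral_prod_right (f := fun x w : ℝ =>
            ‖erl n 1 x * Real.exp (-((a + x) * w))‖) (ν := volume.restrict (Ioi 0)) ?_
          have := (continuous_erl n 1)
          refine Continuous.stronglyMeasurable ?_
          fun_prop
        · filter_upwards [ae_restrict_mem measurableSet_Ioi] with x (hx : 0 < x)
          have h1 : ∫ w in Ioi (0 : ℝ), ‖erl n 1 x * Real.exp (-((a + x) * w))‖ =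
              (a + x)⁻¹ * erl n 1 x := by
            rw [← hin x hx, ← integral_mul_const]
            refine integral_congr_ae (ae_of_all _ fun w => ?_)
            simp [abs_of_nonneg (erl_nonneg n 1 hx.le), mul_comm]
          simp only [Function.uncurry_apply_pair]
          rw [h1, Real.norm_of_nonneg (mul_nonneg (by positivity) (erl_nonneg n 1 hx.le))]
          refine mul_le_mul_of_nonneg_right ?_ (erl_nonneg n 1 hx.le)
          exact inv_anti₀ ha (by linarith)
    · refine Continuous.aestronglyMeasurable ?_
      have := (continuous_erl n 1)
      fun_prop
  have hs := integral_integral_swap hint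
  calc ∫ x in Ioi (0 : ℝ), (a + x)⁻¹ * erl n 1 x
      = ∫ x in Ioi (0 : ℝ), ∫ w in Ioi (0 : ℝ), erl n 1 x * Real.exp (-((a + x) * w)) := by
        refine setIntegral_congr_fun measurableSet_Ioi fun x hx => ?_
        rw [integral_const_mul, hin x hx, mul_comm]
    _ = _ := hs
    _ = _ := by
        refine setIntegral_congr_fun measurableSet_Ioi fun w (hw : 0 < w) => ?_
        rw [← integral_erl n (r := 1 + w) (by linarith), ← integral_const_mul]
        refine integral_congr_ae (ae_of_all _ fun x => ?_)
        simp only [erl]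
        rw [show -((1 + w) * x) = -(1 * x) + -(x * w) by ring,
          show -((a + x) * w) = -(a * w) + -(x * w) by ring, Real.exp_add, Real.exp_add]
        ring

lemma integral_log_one_add_mul_erl_eq_upperGamma (n : ℕ) {c : ℝ} (hc : 0 < c) :
    ∫ x in Ioi (0 : ℝ), Real.log (1 + c * x) * erl n 1 x =
      Real.exp c⁻¹ * ∑ k ∈ Finset.range (n + 1), c⁻¹ ^ k * upperGamma (-(k : ℝ)) c⁻¹ := by
  rw [integral_log_one_add_mul_erl n hc.le, Finset.mul_sum]
  refine Finset.sum_congr rfl fun k _ => ?_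
  rw [← mul_assoc, mul_comm (Real.exp _), ← integral_inv_add_mul_erl k (inv_pos.2 hc)]
  refine setIntegral_congr_fun measurableSet_Ioi fun x (hx : 0 < x) => ?_
  congr 1
  field_simp

/-! ### Logarithmic moments and the digamma function -/

lemma mellin_log_mul_exp_neg {s : ℂ} (hs : 0 < s.re) :
    MellinConvergent (fun t : ℝ => Real.log t • (Real.exp (-t) : ℂ)) s ∧
      HasDerivAt Complex.Gamma (mellin (fun t : ℝ => Real.log t • (Real.exp (-t) : ℂ)) s) s := by
  -- Differentiating the Mellin transform of `exp (-t)` under the integral brings down `log t`. Any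
  -- decay exponent above `s.re` serves at infinity, and boundedness at `0` gives the exponent `0 <
  -- s.re`.
  have h := mellin_hasDerivAt_of_isBigO_rpow (E := ℂ) (a := s.re + 1) (b := 0) (s := s)
    (f := fun t : ℝ => (Real.exp (-t) : ℂ)) ?_ ?_ (lt_add_one _) ?_ hs
  · refine ⟨h.1, ?_⟩
    rw [← Complex.GammaIntegral_eq_mellin] at h
    refine h.2.congr_of_eventuallyEq ?_
    filter_upwards [(isOpen_lt continuous_const Complex.continuous_re).mem_nhds hs] with z hz
    exact Complex.Gamma_eq_integral hz
  · refine (Continuous.continuousOn ?_).locallyIntegrableOn measurableSet_Ioi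
    exact Complex.continuous_ofReal.comp (Real.continuous_exp.comp continuous_neg)
  · rw [← Asymptotics.isBigO_norm_left]
    simp_rw [Complex.norm_real, Asymptotics.isBigO_norm_left]
    simpa only [neg_one_mul] using (isLittleO_exp_neg_mul_rpow_atTop zero_lt_one _).isBigO
  · simp_rw [neg_zero, Real.rpow_zero]
    refine Asymptotics.isBigO_const_of_tendsto (?_ : Tendsto _ _ (𝓝 (1 : ℂ))) one_ne_zero
    rw [(by simp : (1 : ℂ) = Real.exp (-0))]
    exact (Complex.continuous_ofReal.comp
      (Real.continuous_exp.comp continuous_neg)).continuousWithinAt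

lemma psi_natCast_add_one (k : ℕ) {d : ℝ} (hd : HasDerivAt Complex.Gamma d (k + 1)) :
    psi (k + 1) = d / k.factorial := by
  rw [psi]
  push_cast
  rw [Complex.digamma_def, logDeriv_apply, hd.deriv, Complex.Gamma_nat_eq_factorial]
  norm_cast

lemma log_mul_erl_one (k : ℕ) :
    IntegrableOn (fun t => Real.log t * erl k 1 t) (Ioi 0) ∧
      ∫ t in Ioi (0 : ℝ), Real.log t * erl k 1 t = psi (k + 1) := by
  have hk : 0 < ((k : ℂ) + 1).re := by simp; positivity
  obtain ⟨h1, h2⟩ := mellin_log_mul_exp_neg hk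
  have he : ∀ t : ℝ, ((t : ℂ) ^ ((k : ℂ) + 1 - 1) • (Real.log t • (Real.exp (-t) : ℂ)))
      = ((k.factorial * (Real.log t * erl k 1 t) : ℝ) : ℂ) := fun t => by
    simp only [add_sub_cancel_right, Complex.cpow_natCast, smul_eq_mul, Complex.real_smul, erl,
      one_mul]
    push_cast
    rw [div_mul_eq_mul_div, mul_div_assoc', mul_div_assoc']
    rw [eq_div_iff (by exact_mod_cast k.factorial_ne_zero)]
    ring
  have hf : (k.factorial : ℝ) ≠ 0 := by positivity
  rw [MellinConvergent] at h1
  rw [mellin] at h2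
  simp_rw [he] at h1 h2
  have hi : IntegrableOn (fun t => Real.log t * erl k 1 t) (Ioi 0) := by
    have := (h1.re).const_mul ((k.factorial : ℝ)⁻¹)
    refine this.congr (ae_of_all _ fun t => ?_)
    simp only [Complex.ofReal_re, RCLike.re_eq_complex_re]
    field_simp
  refine ⟨hi, ?_⟩
  rw [integral_complex_ofReal] at h2
  rw [psi_natCast_add_one k h2, integral_const_mul]
  field_simp

lemma integrableOn_log_mul_erl (k : ℕ) {r : ℝ} (hr : 0 < r) :
    IntegrableOn (fun t => Real.log t * erl k r t) (Ioi 0) := by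
  have h := (integrableOn_Ioi_comp_mul_left_iff (fun t => Real.log t * erl k 1 t) 0 hr).2
    (by simpa using (log_mul_erl_one k).1)
  have h2 := (h.const_mul ((r ^ k)⁻¹)).sub ((integrableOn_erl k hr).const_mul (Real.log r))
  refine IntegrableOn.congr_fun h2 (fun t (ht : 0 < t) => ?_) measurableSet_Ioi
  simp only [Pi.sub_apply, erl_mul_left k, one_mul, Real.log_mul hr.ne' ht.ne']
  field_simp
  ring

lemma integral_log_mul_erl (k : ℕ) {r : ℝ} (hr : 0 < r) :
    ∫ t in Ioi (0 : ℝ), Real.log t * erl k r t = (r ^ (k + 1))⁻¹ * (psi (k + 1) - Real.log r) := by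
  have h := integral_comp_mul_left_Ioi (fun t => Real.log t * erl k 1 t) 0 hr
  rw [mul_zero, (log_mul_erl_one k).2] at h
  have h2 : ∫ t in Ioi (0 : ℝ), Real.log (r * t) * erl k 1 (r * t) =
      ∫ t in Ioi (0 : ℝ), (r ^ k * (Real.log t * erl k r t) + r ^ k * Real.log r * erl k r t) := by
    refine setIntegral_congr_fun measurableSet_Ioi fun t (ht : 0 < t) => ?_
    simp only [erl_mul_left k, one_mul, Real.log_mul hr.ne' ht.ne']
    ring
  rw [h2, integral_add ((integrableOn_log_mul_erl k hr).const_mul _)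
    ((integrableOn_erl k hr).const_mul _), integral_const_mul, integral_const_mul,
    integral_erl k hr, smul_eq_mul] at h
  have hk := pow_pos hr k
  have hr' := hr.ne'
  rw [eq_inv_mul_iff_mul_eq₀ (by positivity)]
  have h3 := congrArg (r * ·) h
  simp only [mul_inv_cancel_left₀ hr'] at h3
  rw [← h3, pow_succ]
  field_simp
  ring

/-! ### Mellin transforms and the Meijer function -/

/-- The Mellin transform of `t ↦ ∫ k(x) G(t x) dx` is `mellin G p * mellin k (1 - p)`. -/
lemma hasMellin_integral_mul_comp_mul {k G : ℝ → ℂ} {p : ℂ} (hkm : Measurable k)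
    (hGm : Measurable G) (hG : MellinConvergent G p) (hk : MellinConvergent k (1 - p)) :
    HasMellin (fun t : ℝ => ∫ x in Ioi (0 : ℝ), k x * G (t * x)) p
      (mellin G p * mellin k (1 - p)) := by
  set F : ℝ → ℝ → ℂ := fun t x => (t : ℂ) ^ (p - 1) * (k x * G (t * x)) with hF
  -- Since `t ^ (p - 1) = x ^ (1 - p) * (t x) ^ (p - 1)`, the integrand separates in the variables
  -- `x` and `t x`.
  have hscale : ∀ x : ℝ, 0 < x → ∀ t : ℝ, 0 < t →
      F t x = (k x * (x : ℂ) ^ (1 - p)) * (((t * x : ℝ) : ℂ) ^ (p - 1) * G (t * x)) := by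
    intro x hx t ht
    simp only [hF]
    rw [Complex.ofReal_mul, Complex.mul_cpow_ofReal_nonneg ht.le hx.le]
    have : (x : ℂ) ^ (1 - p) * (x : ℂ) ^ (p - 1) = 1 := by
      rw [← Complex.cpow_add _ _ (by exact_mod_cast hx.ne')]; simp
    linear_combination (-(k x * G (t * x) * (t : ℂ) ^ (p - 1))) * this
  -- The Jacobian `x⁻¹` of the substitution `t x` supplies the missing power, leaving the Mellin
  -- integrand of `k` at `1 - p`.
  have hx1 : ∀ x : ℝ, 0 < x → (x : ℂ) ^ (1 - p) * (x : ℂ)⁻¹ = (x : ℂ) ^ (1 - p - 1) := by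
    intro x hx
    rw [← Complex.cpow_neg_one, ← Complex.cpow_add _ _ (by exact_mod_cast hx.ne')]
    ring_nf
  have hint : Integrable (Function.uncurry F)
      ((volume.restrict (Ioi 0)).prod (volume.restrict (Ioi 0))) := by
    have hFm : AEStronglyMeasurable (Function.uncurry F)
        ((volume.restrict (Ioi 0)).prod (volume.restrict (Ioi 0))) := by
      refine Measurable.aestronglyMeasurable ?_
      simp only [hF, Function.uncurry_def]
      fun_prop
    rw [integrable_prod_iff' hFm]
    constructor
    · filter_upwards [ae_restrict_mem measurableSet_Ioi] with x (hx : 0 < x)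
      have h := (integrableOn_Ioi_comp_mul_right_iff
        (fun t : ℝ => (t : ℂ) ^ (p - 1) * G t) 0 hx).2 (by simpa [MellinConvergent] using hG)
      have h2 := h.const_mul (k x * (x : ℂ) ^ (1 - p))
      exact IntegrableOn.congr_fun h2 (fun t ht => (hscale x hx t ht).symm) measurableSet_Ioi
    · have h := (hk.norm).mul_const (∫ t in Ioi (0 : ℝ), ‖(t : ℂ) ^ (p - 1) * G t‖)
      refine IntegrableOn.congr_fun h (fun x (hx : 0 < x) => ?_) measurableSet_Ioi
      have h2 := integral_comp_mul_right_Ioi (fun t : ℝ => ‖(t : ℂ) ^ (p - 1) * G t‖) 0 hx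
      rw [zero_mul] at h2
      have h3 : ∫ t in Ioi (0 : ℝ), ‖Function.uncurry F (t, x)‖ =
          ∫ t in Ioi (0 : ℝ), ‖k x * (x : ℂ) ^ (1 - p)‖ *
            ‖((t * x : ℝ) : ℂ) ^ (p - 1) * G (t * x)‖ := by
        refine setIntegral_congr_fun measurableSet_Ioi fun t (ht : 0 < t) => ?_
        simp only [Function.uncurry_apply_pair, hscale x hx t ht, norm_mul]
      rw [h3, integral_const_mul, h2, smul_eq_mul, ← hx1 x hx]
      simp only [norm_mul, smul_eq_mul, norm_inv, Complex.norm_real, Real.norm_of_nonneg hx.le]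
      ring
  have hcongr : ∀ t : ℝ, ∫ x in Ioi (0 : ℝ), F t x =
      (t : ℂ) ^ (p - 1) • ∫ x in Ioi (0 : ℝ), k x * G (t * x) := fun t => by
    simp only [hF]; rw [integral_const_mul, smul_eq_mul]
  constructor
  · exact hint.integral_prod_left.congr (ae_of_all _ hcongr)
  · rw [mellin]
    simp_rw [← hcongr]
    rw [integral_integral_swap hint]
    have h4 : ∀ x ∈ Ioi (0 : ℝ), ∫ t in Ioi (0 : ℝ), F t x =
        mellin G p * ((x : ℂ) ^ (1 - p - 1) • k x) := by
      intro x (hx : 0 < x)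
      have h2 := integral_comp_mul_right_Ioi (fun t : ℝ => (t : ℂ) ^ (p - 1) * G t) 0 hx
      rw [zero_mul] at h2
      rw [setIntegral_congr_fun measurableSet_Ioi (hscale x hx), integral_const_mul, h2,
        ← hx1 x hx, mellin]
      simp only [smul_eq_mul, Complex.real_smul, Complex.ofReal_inv]
      ring
    rw [setIntegral_congr_fun measurableSet_Ioi h4, integral_const_mul]
    rfl

lemma hasMellin_congr {f g : ℝ → ℂ} {s m : ℂ} (hf : HasMellin f s m)
    (h : ∀ t, 0 < t → f t = g t) : HasMellin g s m := by
  have he : EqOn (fun t : ℝ => (t : ℂ) ^ (s - 1) • f t) (fun t : ℝ => (t : ℂ) ^ (s - 1) • g t)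
      (Ioi 0) := fun t ht => by simp only [h t ht]
  refine ⟨IntegrableOn.congr_fun hf.1 he measurableSet_Ioi, ?_⟩
  rw [← hf.2, mellin, mellin, setIntegral_congr_fun measurableSet_Ioi he]

lemma hasMellin_exp_neg {s : ℂ} (hs : 0 < s.re) :
    HasMellin (fun t : ℝ => (Real.exp (-t) : ℂ)) s (Complex.Gamma s) := by
  constructor
  · have := Complex.GammaIntegral_convergent hs
    refine this.congr (ae_of_all _ fun t => ?_)
    simp [mul_comm]
  · rw [Complex.Gamma_eq_integral hs, Complex.GammaIntegral_eq_mellin]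

lemma hasMellin_erl_one (m : ℕ) {s : ℂ} (hs : 0 < s.re + m) :
    HasMellin (fun t : ℝ => (erl m 1 t : ℂ)) s (Complex.Gamma (s + m) / m.factorial) := by
  have h := hasMellin_exp_neg (s := s + m) (by simpa using hs)
  have h1 : MellinConvergent (fun t : ℝ => (t : ℂ) ^ (m : ℂ) • (Real.exp (-t) : ℂ)) s :=
    MellinConvergent.cpow_smul.2 h.1
  have h2 := mellin_cpow_smul (fun t : ℝ => (Real.exp (-t) : ℂ)) s m
  rw [h.2] at h2
  have h3 : HasMellin (fun t : ℝ => ((t : ℂ) ^ (m : ℂ) • (Real.exp (-t) : ℂ)) / m.factorial) s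
      (Complex.Gamma (s + m) / m.factorial) :=
    ⟨h1.div_const _, by rw [mellin_div_const, h2]⟩
  refine hasMellin_congr h3 fun t _ => ?_
  simp only [erl, Complex.cpow_natCast, smul_eq_mul, one_mul]
  push_cast
  ring

/-- The function `(1 + t)⁻¹` is the integral of `exp (-x) * exp (-(t x))`, a Mellin convolution of
the exponential with itself. -/
lemma hasMellin_inv_one_add {p : ℂ} (h0 : 0 < p.re) (h1 : p.re < 1) :
    HasMellin (fun t : ℝ => ((1 + t)⁻¹ : ℂ)) p (Complex.Gamma p * Complex.Gamma (1 - p)) := by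
  have hp : 0 < (1 - p).re := by simpa using h1
  have h := hasMellin_integral_mul_comp_mul (k := fun t : ℝ => (Real.exp (-t) : ℂ))
    (G := fun t : ℝ => (Real.exp (-t) : ℂ)) (by fun_prop) (by fun_prop)
    (hasMellin_exp_neg h0).1 (hasMellin_exp_neg hp).1
  rw [(hasMellin_exp_neg h0).2, (hasMellin_exp_neg hp).2] at h
  refine hasMellin_congr h fun t ht => ?_
  have h2 := integral_cpow_mul_cexp_neg 0 (c := 1 + t) (by simp; positivity)
  simp only [pow_zero, one_mul, Nat.factorial_zero, Nat.cast_one, zero_add, pow_one,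
    one_div] at h2
  rw [← h2]
  refine integral_congr_ae (ae_of_all _ fun x => ?_)
  simp only
  rw [← Complex.ofReal_mul, ← Real.exp_add]
  push_cast
  congr 1
  ring

/-- The expectation of `(1 + t X)⁻¹` for `X` of the gamma law of shape `m + 1` and rate `1`. -/
def invGamma (m : ℕ) (t : ℝ) : ℝ := ∫ x in Ioi (0 : ℝ), (1 + t * x)⁻¹ * erl m 1 x

lemma measurable_invGamma (m : ℕ) : Measurable (invGamma m) := by
  refine StronglyMeasurable.measurable ?_
  refine StronglyMeasurable.integral_prod_right (f := fun t x : ℝ => (1 + t * x)⁻¹ * erl m 1 x)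
    (ν := volume.restrict (Ioi 0)) ?_
  have := (continuous_erl m 1).measurable
  refine Measurable.stronglyMeasurable ?_
  fun_prop

lemma invGamma_nonneg (m : ℕ) {t : ℝ} (ht : 0 ≤ t) : 0 ≤ invGamma m t := by
  refine setIntegral_nonneg measurableSet_Ioi fun x (hx : 0 < x) => ?_
  exact mul_nonneg (by positivity) (erl_nonneg m 1 hx.le)

lemma invGamma_le_one (m : ℕ) {t : ℝ} (ht : 0 ≤ t) : invGamma m t ≤ 1 := by
  have h1 : ∫ x in Ioi (0 : ℝ), erl m 1 x = 1 := by simpa using integral_erl m one_pos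
  rw [← h1, invGamma]
  have hle : ∀ x ∈ Ioi (0 : ℝ), (1 + t * x)⁻¹ * erl m 1 x ≤ erl m 1 x := fun x (hx : 0 < x) => by
    have := mul_nonneg ht hx.le
    exact mul_le_of_le_one_left (erl_nonneg m 1 hx.le) (inv_le_one_of_one_le₀ (by linarith))
  refine setIntegral_mono_on ?_ (integrableOn_erl m one_pos) measurableSet_Ioi hle
  refine (integrableOn_erl m one_pos).mono' ?_ ?_
  · have := (continuous_erl m 1).measurable
    fun_prop
  · filter_upwards [ae_restrict_mem measurableSet_Ioi] with x (hx : 0 < x)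
    rw [Real.norm_of_nonneg (mul_nonneg (by positivity) (erl_nonneg m 1 hx.le))]
    exact hle x hx

lemma integral_div_one_add_mul_erl (m : ℕ) (c : ℝ) :
    ∫ x in Ioi (0 : ℝ), c / (1 + c * x) * erl m 1 x = c * invGamma m c := by
  rw [invGamma, ← integral_const_mul]
  refine integral_congr_ae (ae_of_all _ fun x => ?_)
  simp only; ring

lemma hasMellin_invGamma (m : ℕ) {p : ℂ} (h0 : 0 < p.re) (h1 : p.re < 1) :
    HasMellin (fun t : ℝ => (invGamma m t : ℂ)) p
      (Complex.Gamma p * Complex.Gamma (1 - p) * (Complex.Gamma (1 - p + m) / m.factorial)) := by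
  have hp : 0 < (1 - p).re + m := by
    have : 0 < (1 - p).re := by simpa using h1
    positivity
  have hc := (continuous_erl m 1).measurable
  have h := hasMellin_integral_mul_comp_mul (k := fun t : ℝ => (erl m 1 t : ℂ))
    (G := fun t : ℝ => ((1 + t)⁻¹ : ℂ)) (by fun_prop) (by fun_prop)
    (hasMellin_inv_one_add h0 h1).1 (hasMellin_erl_one m hp).1
  rw [(hasMellin_inv_one_add h0 h1).2, (hasMellin_erl_one m hp).2] at h
  refine hasMellin_congr h fun t ht => ?_
  rw [invGamma, ← integral_complex_ofReal]
  refine integral_congr_ae (ae_of_all _ fun x => ?_)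
  push_cast
  ring

/-- The Laplace transform of `t ^ n * invGamma m t`. -/
def laplaceInvGamma (n m : ℕ) (z : ℝ) : ℝ :=
  ∫ t in Ioi (0 : ℝ), t ^ n * invGamma m t * Real.exp (-(z * t))

lemma integrableOn_pow_mul_invGamma_mul_exp (n m : ℕ) {z : ℝ} (hz : 0 < z) :
    IntegrableOn (fun t => t ^ n * invGamma m t * Real.exp (-(z * t))) (Ioi 0) := by
  have := measurable_invGamma m
  refine (integrableOn_pow_mul_exp_neg n hz).mono' (by fun_prop) ?_
  filter_upwards [ae_restrict_mem measurableSet_Ioi] with t (ht : 0 < t)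
  have h0 := invGamma_nonneg m ht.le
  rw [Real.norm_of_nonneg (by positivity)]
  exact mul_le_mul_of_nonneg_right
    (mul_le_of_le_one_right (by positivity) (invGamma_le_one m ht.le)) (Real.exp_pos _).le

lemma continuousAt_laplaceInvGamma (n m : ℕ) {z : ℝ} (hz : 0 < z) :
    ContinuousAt (laplaceInvGamma n m) z := by
  have hm := measurable_invGamma m
  refine continuousAt_of_dominated
    (bound := fun t => t ^ n * invGamma m t * Real.exp (-(z / 2 * t))) ?_ ?_
    (integrableOn_pow_mul_invGamma_mul_exp n m (half_pos hz)) ?_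
  · exact Eventually.of_forall fun w => by fun_prop
  · filter_upwards [lt_mem_nhds (half_lt_self hz)] with w hw
    filter_upwards [ae_restrict_mem measurableSet_Ioi] with t (ht : 0 < t)
    have h0 := invGamma_nonneg m ht.le
    rw [Real.norm_of_nonneg (by positivity)]
    gcongr
  · exact ae_of_all _ fun t => by fun_prop

/-- A Laplace transform is a Mellin convolution with `exp (-t)`; the factor `t ^ n` shifts the
argument by `n`. The strip `0 < Re p < 1` for `p = 1 - u + n` becomes `n < Re u < n + 1`. -/
lemma hasMellin_laplaceInvGamma (n m : ℕ) {u : ℂ} (h0 : (n : ℝ) < u.re) (h1 : u.re < n + 1) :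
    HasMellin (fun z : ℝ => (laplaceInvGamma n m z : ℂ)) u
      (Complex.Gamma u * (Complex.Gamma (n + 1 - u) * Complex.Gamma (u - n) *
        (Complex.Gamma (u - n + m) / m.factorial))) := by
  have hu : 0 < u.re := lt_of_le_of_lt n.cast_nonneg h0
  have hm := measurable_invGamma m
  have hq := hasMellin_invGamma m (p := 1 - u + n) (by simp; linarith) (by simp; linarith)
  have h2 : MellinConvergent (fun t : ℝ => (t : ℂ) ^ (n : ℂ) • (invGamma m t : ℂ)) (1 - u) :=
    MellinConvergent.cpow_smul.2 hq.1
  have h3 := mellin_cpow_smul (fun t : ℝ => (invGamma m t : ℂ)) (1 - u) n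
  rw [hq.2] at h3
  have h := hasMellin_integral_mul_comp_mul
    (k := fun t : ℝ => (t : ℂ) ^ (n : ℂ) • (invGamma m t : ℂ))
    (G := fun t : ℝ => (Real.exp (-t) : ℂ)) (by fun_prop) (by fun_prop)
    (hasMellin_exp_neg hu).1 h2
  rw [(hasMellin_exp_neg hu).2, h3, show 1 - u + n = n + 1 - u by ring,
    show 1 - ((n : ℂ) + 1 - u) = u - n by ring] at h
  refine hasMellin_congr h fun z _ => ?_
  rw [laplaceInvGamma, ← integral_complex_ofReal]
  refine integral_congr_ae (ae_of_all _ fun t => ?_)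
  simp

/-! ### Decay of the gamma function on vertical lines and Mellin inversion -/

lemma norm_Gamma_le {s : ℂ} (hs : 0 < s.re) : ‖Complex.Gamma s‖ ≤ Real.Gamma s.re := by
  rw [Complex.Gamma_eq_integral hs, Real.Gamma_eq_integral hs, Complex.GammaIntegral]
  refine (norm_integral_le_integral_norm _).trans_eq ?_
  refine setIntegral_congr_fun measurableSet_Ioi fun x (hx : 0 < x) => ?_
  simp [Complex.norm_cpow_eq_rpow_re_of_pos hx, Complex.norm_exp]

lemma continuous_Gamma_vertical {σ : ℝ} (hσ : 0 < σ) :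
    Continuous fun y : ℝ => Complex.Gamma (σ + y * Complex.I) := by
  refine continuous_iff_continuousAt.2 fun y => ?_
  refine ContinuousAt.comp (g := Complex.Gamma) ?_ (by fun_prop)
  refine Complex.continuousAt_Gamma _ fun m h => ?_
  have := congrArg Complex.re h
  simp at this
  have hm := m.cast_nonneg (α := ℝ)
  linarith

/-- Use `Γ(u + 2) = (u + 1) u Γ(u)`: the left side is at most `Γ(σ + 2)` in norm, and both `‖u‖ ^ 2`
and `‖u + 1‖ ^ 2` are at least `1 + y ^ 2` because `σ ≥ 1`. -/
lemma norm_Gamma_vertical_le {σ : ℝ} (hσ : 1 ≤ σ) (y : ℝ) :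
    ‖Complex.Gamma (σ + y * Complex.I)‖ ≤ Real.Gamma (σ + 2) * (1 + y ^ 2)⁻¹ := by
  set u : ℂ := σ + y * Complex.I with hu
  have hre : u.re = σ := by simp [hu]
  have him : u.im = y := by simp [hu]
  have h0 : u ≠ 0 := fun h => by rw [h] at hre; simp at hre; linarith
  have h1 : u + 1 ≠ 0 := fun h => by
    have := congrArg Complex.re h
    simp [hre] at this; linarith
  have h2 : Complex.Gamma (u + 2) = (u + 1) * (u * Complex.Gamma u) := by
    rw [← Complex.Gamma_add_one u h0, ← Complex.Gamma_add_one (u + 1) h1]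
    ring_nf
  have h3 : ‖Complex.Gamma (u + 2)‖ ≤ Real.Gamma (σ + 2) := by
    have := norm_Gamma_le (s := u + 2) (by simp [hre]; linarith)
    simpa [hre] using this
  have hb : ∀ w : ℂ, 1 ≤ w.re → w.im = y → 1 + y ^ 2 ≤ ‖w‖ ^ 2 := fun w h1 h2 => by
    rw [← Complex.normSq_eq_norm_sq, Complex.normSq_apply, h2]
    nlinarith
  have h4 := hb u (by rw [hre]; exact hσ) him
  have h5 := hb (u + 1) (by simp [hre]; linarith) (by simp [him])
  have h6 : 1 + y ^ 2 ≤ ‖u + 1‖ * ‖u‖ := by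
    refine abs_le_of_sq_le_sq' ?_ (by positivity) |>.2
    rw [mul_pow, sq (1 + y ^ 2)]
    exact mul_le_mul h5 h4 (by positivity) (by positivity)
  rw [← div_eq_mul_inv, le_div_iff₀ (by positivity)]
  rw [h2, norm_mul, norm_mul, ← mul_assoc] at h3
  calc ‖Complex.Gamma u‖ * (1 + y ^ 2) ≤ ‖Complex.Gamma u‖ * (‖u + 1‖ * ‖u‖) := by gcongr
    _ ≤ _ := by linarith

lemma meijerKernel_eq (n m : ℕ) (u : ℂ) :
    meijerKernel [-(n : ℝ)] [] [-(n : ℝ), (m : ℝ) - n, 0] [] u =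
      m.factorial * (Complex.Gamma u * (Complex.Gamma (n + 1 - u) * Complex.Gamma (u - n) *
        (Complex.Gamma (u - n + m) / m.factorial))) := by
  have : (m.factorial : ℂ) ≠ 0 := by exact_mod_cast m.factorial_ne_zero
  simp only [meijerKernel, List.bind_eq_flatMap, List.pure_def, List.flatMap_cons,
    List.flatMap_nil, List.singleton_append, List.map_cons, List.map_nil, List.prod_cons,
    List.prod_nil]
  push_cast
  rw [show -(n : ℂ) + u = u - n by ring, show (m : ℂ) - n + u = u - n + m by ring,
    show 1 - -(n : ℂ) - u = n + 1 - u by ring, zero_add]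
  field_simp

/-- The factor `Γ(u)` alone gives quadratic decay, as `σ > n ≥ 1`; the other three are bounded by
their values on the real axis, where their arguments are positive. -/
lemma verticalIntegrable_laplaceInvGamma {n m : ℕ} (hn : 1 ≤ n) {σ : ℝ} (h0 : (n : ℝ) < σ)
    (h1 : σ < n + 1) :
    Complex.VerticalIntegrable (mellin fun z : ℝ => (laplaceInvGamma n m z : ℂ)) σ := by
  have hn' : (1 : ℝ) ≤ n := by exact_mod_cast hn
  have he : ∀ y : ℝ, mellin (fun z : ℝ => (laplaceInvGamma n m z : ℂ)) (σ + y * Complex.I) =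
      Complex.Gamma (σ + y * Complex.I) *
        (Complex.Gamma ((n + 1 - σ : ℝ) + (-y : ℝ) * Complex.I) *
          Complex.Gamma ((σ - n : ℝ) + y * Complex.I) *
        (Complex.Gamma ((σ - n + m : ℝ) + y * Complex.I) / m.factorial)) := fun y => by
    rw [(hasMellin_laplaceInvGamma n m (u := σ + y * Complex.I) (by simpa) (by simpa)).2]
    push_cast
    congr 3
    · congr 1
      ring_nf
    · congr 1
      ring
    · ring_nf
  have hc : Continuous fun y : ℝ =>
      Complex.Gamma ((n + 1 - σ : ℝ) + (-y : ℝ) * Complex.I) :=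
    (continuous_Gamma_vertical (σ := n + 1 - σ) (by linarith)).comp continuous_neg
  have hc2 := continuous_Gamma_vertical (σ := σ - n) (by linarith)
  have hc3 := continuous_Gamma_vertical (σ := σ - n + m)
    (by have := m.cast_nonneg (α := ℝ); linarith)
  have hc4 := continuous_Gamma_vertical (σ := σ) (by linarith)
  rw [Complex.VerticalIntegrable]
  simp_rw [he]
  refine (integrable_inv_one_add_sq.const_mul (Real.Gamma (σ + 2) *
    (Real.Gamma (n + 1 - σ) * Real.Gamma (σ - n) * (Real.Gamma (σ - n + m) / m.factorial)))).mono'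
    (by fun_prop) (ae_of_all _ fun y => ?_)
  have hg : ∀ (τ : ℝ) (_ : 0 < τ) (y : ℝ), ‖Complex.Gamma (τ + y * Complex.I)‖ ≤ Real.Gamma τ :=
    fun τ hτ y => by simpa using norm_Gamma_le (s := τ + y * Complex.I) (by simpa)
  have hm := m.cast_nonneg (α := ℝ)
  have g1 := hg (n + 1 - σ) (by linarith) (-y)
  have g2 := hg (σ - n) (by linarith) y
  have g3 := hg (σ - n + m) (by linarith) y
  have g4 := norm_Gamma_vertical_le (σ := σ) (by linarith) y
  have p1 : 0 ≤ Real.Gamma (n + 1 - σ) := (norm_nonneg _).trans g1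
  have p2 : 0 ≤ Real.Gamma (σ - n) := (norm_nonneg _).trans g2
  have p3 : 0 ≤ Real.Gamma (σ - n + m) := (norm_nonneg _).trans g3
  have p4 := (norm_nonneg _).trans g4
  rw [norm_mul, norm_mul, norm_mul, norm_div, Complex.norm_natCast]
  calc _ ≤ (Real.Gamma (σ + 2) * (1 + y ^ 2)⁻¹) * (Real.Gamma (n + 1 - σ) * Real.Gamma (σ - n) *
        (Real.Gamma (σ - n + m) / m.factorial)) := by gcongr
    _ = _ := by ring

lemma meijerG_eq_laplaceInvGamma {n m : ℕ} (hn : 1 ≤ n) {z : ℝ} (hz : 0 < z) :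
    meijerG [-(n : ℝ)] [] [-(n : ℝ), (m : ℝ) - n, 0] [] z =
      m.factorial * laplaceInvGamma n m z := by
  have hn' : (1 : ℝ) ≤ n := by exact_mod_cast hn
  have hm := m.cast_nonneg (α := ℝ)
  have hex : ∃ σ, Separates [-(n : ℝ)] [-(n : ℝ), (m : ℝ) - n, 0] σ := by
    -- The separating lines are those with `n < σ < n + 1`; take the middle one.
    refine ⟨n + 1 / 2, ?_, ?_⟩
    · simp only [List.mem_cons, List.not_mem_nil, or_false, forall_eq_or_imp, forall_eq]
      refine ⟨by linarith, by linarith, by linarith⟩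
    · simp only [List.mem_cons, List.not_mem_nil, or_false, forall_eq]
      linarith
  rw [meijerG, dif_pos hex]
  -- The chosen line is unspecified, but separation forces it into the strip where the Mellin
  -- transform was computed, and inversion holds on every line of that strip.
  obtain ⟨hb, ha⟩ := hex.choose_spec
  set σ := hex.choose
  have h0 : (n : ℝ) < σ := by simpa using hb (-(n : ℝ)) (by simp)
  have h1 : σ < n + 1 := by
    have := ha (-(n : ℝ)) (by simp)
    linarith
  have hinv := mellinInv_mellin_eq σ (fun z : ℝ => (laplaceInvGamma n m z : ℂ)) hz
    (hasMellin_laplaceInvGamma n m (u := σ) (by simpa) (by simpa)).1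
    (verticalIntegrable_laplaceInvGamma hn h0 h1)
    (Complex.continuous_ofReal.continuousAt.comp (continuousAt_laplaceInvGamma n m hz))
  rw [← hinv, mellinInv, mellinInv, mul_smul_comm, ← integral_const_mul]
  congr 1
  refine integral_congr_ae (ae_of_all _ fun y => ?_)
  simp only
  rw [meijerKernel_eq, (hasMellin_laplaceInvGamma n m (u := σ + y * Complex.I) (by simpa)
    (by simpa)).2, smul_eq_mul, smul_eq_mul]
  ring

/-! ### Gamma laws -/

/-- The gamma law of shape `k + 1` and rate `r`. -/
def erlang (k : ℕ) (r : ℝ) : Measure ℝ :=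
  (volume.restrict (Ioi 0)).withDensity fun t => ENNReal.ofReal (r ^ (k + 1) * erl k r t)

lemma measurable_ofReal_mul_erl (k : ℕ) (r : ℝ) :
    Measurable fun t => ENNReal.ofReal (r ^ (k + 1) * erl k r t) := by
  have := (continuous_erl k r).measurable
  fun_prop

lemma integrable_erlang_iff {E : Type*} [NormedAddCommGroup E] [NormedSpace ℝ E] (k : ℕ) {r : ℝ}
    (hr : 0 < r) {f : ℝ → E} :
    Integrable f (erlang k r) ↔ IntegrableOn (fun t => erl k r t • f t) (Ioi 0) := by
  rw [erlang, integrable_withDensity_iff_integrable_smul' (measurable_ofReal_mul_erl k r)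
    (ae_of_all _ fun _ => ENNReal.ofReal_lt_top), IntegrableOn,
    ← integrable_smul_iff (pow_pos hr (k + 1)).ne' (fun t => erl k r t • f t), ← IntegrableOn,
    ← IntegrableOn]
  refine integrableOn_congr_fun (fun t (ht : 0 < t) => ?_) measurableSet_Ioi
  rw [ENNReal.toReal_ofReal (mul_nonneg (by positivity) (erl_nonneg k r ht.le)), Pi.smul_apply,
    mul_smul]

lemma integral_erlang {E : Type*} [NormedAddCommGroup E] [NormedSpace ℝ E] (k : ℕ) {r : ℝ}
    (hr : 0 < r) (f : ℝ → E) :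
    ∫ t, f t ∂erlang k r = r ^ (k + 1) • ∫ t in Ioi (0 : ℝ), erl k r t • f t := by
  rw [erlang, integral_withDensity_eq_integral_toReal_smul (measurable_ofReal_mul_erl k r)
    (ae_of_all _ fun _ => ENNReal.ofReal_lt_top), ← integral_smul]
  refine setIntegral_congr_fun measurableSet_Ioi fun t (ht : 0 < t) => ?_
  rw [ENNReal.toReal_ofReal (mul_nonneg (by positivity) (erl_nonneg k r ht.le)), mul_smul]

lemma isProbabilityMeasure_erlang (k : ℕ) {r : ℝ} (hr : 0 < r) :
    IsProbabilityMeasure (erlang k r) := by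
  have hi : IntegrableOn (fun t => r ^ (k + 1) * erl k r t) (Ioi 0) :=
    (integrableOn_erl k hr).const_mul _
  constructor
  rw [erlang, withDensity_apply _ MeasurableSet.univ, Measure.restrict_univ,
    ← ofReal_integral_eq_lintegral_ofReal hi, integral_const_mul, integral_erl k hr,
    mul_inv_cancel₀ (pow_pos hr _).ne', ENNReal.ofReal_one]
  filter_upwards [ae_restrict_mem measurableSet_Ioi] with t (ht : 0 < t)
  exact mul_nonneg (by positivity) (erl_nonneg k r ht.le)

lemma ae_erlang_pos (k : ℕ) (r : ℝ) : ∀ᵐ t ∂erlang k r, 0 < t :=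
  (withDensity_absolutelyContinuous _ _) (ae_restrict_mem measurableSet_Ioi)

lemma integral_erl_mul_cexp (k : ℕ) {r : ℝ} (hr : 0 < r) (t : ℝ) :
    ∫ x in Ioi (0 : ℝ), erl k r x • Complex.exp (t * x * Complex.I) =
      1 / (r - t * Complex.I) ^ (k + 1) := by
  have hk : (k.factorial : ℂ) ≠ 0 := by exact_mod_cast k.factorial_ne_zero
  have h := integral_cpow_mul_cexp_neg k (c := r - t * Complex.I) (by simpa)
  have h2 : ∀ x : ℝ, erl k r x • Complex.exp (t * x * Complex.I) =
      (k.factorial : ℂ)⁻¹ * ((x : ℂ) ^ k * Complex.exp (-((r - t * Complex.I) * x))) := fun x => by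
    rw [show -(((r : ℂ) - t * Complex.I) * x) = -(r * x) + t * x * Complex.I by ring,
      Complex.exp_add, erl, Complex.real_smul]
    push_cast
    ring
  simp_rw [h2]
  rw [integral_const_mul, h, div_eq_mul_inv, inv_mul_cancel_left₀ hk, one_div]

lemma charFun_erlang (k : ℕ) {r : ℝ} (hr : 0 < r) (t : ℝ) :
    charFun (erlang k r) t = (r / (r - t * Complex.I)) ^ (k + 1) := by
  rw [charFun_apply_real, integral_erlang k hr, integral_erl_mul_cexp k hr, Complex.real_smul,
    div_pow]
  push_cast
  ring

lemma erlang_map_mul (k : ℕ) {c : ℝ} (hc : 0 < c) :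
    (erlang k 1).map (fun x => c⁻¹ * x) = erlang k c := by
  have := isProbabilityMeasure_erlang k one_pos
  have := isProbabilityMeasure_erlang k hc
  have : IsProbabilityMeasure ((erlang k 1).map (fun x => c⁻¹ * x)) :=
    Measure.isProbabilityMeasure_map (by fun_prop)
  refine Measure.ext_of_charFun (funext fun t => ?_)
  have hc' : (c : ℂ) ≠ 0 := by exact_mod_cast hc.ne'
  rw [charFun_map_mul, charFun_erlang k one_pos, charFun_erlang k hc]
  congr 1
  rw [show (c : ℂ) - t * Complex.I = c * (1 - c⁻¹ * t * Complex.I) by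
    push_cast; linear_combination (t * Complex.I) * mul_inv_cancel₀ hc']
  rw [div_mul_eq_div_div, div_self hc']
  push_cast
  rfl

/-! ### Complex Gaussian vectors -/

lemma stdComplexGaussian_eq_map :
    stdComplexGaussian = ((gaussianReal 0 (1 / 2)).prod (gaussianReal 0 (1 / 2))).map
      Complex.measurableEquivRealProd.symm := rfl

instance : IsProbabilityMeasure stdComplexGaussian := by
  rw [stdComplexGaussian_eq_map]
  exact Measure.isProbabilityMeasure_map (MeasurableEquiv.measurable _).aemeasurable

lemma charFun_stdComplexGaussian (t : ℂ) :
    charFun stdComplexGaussian t = Complex.exp (-(‖t‖ ^ 2 / 4 : ℝ)) := by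
  rw [charFun_apply, stdComplexGaussian_eq_map, integral_map_equiv]
  have h : ∀ p : ℝ × ℝ, Complex.exp ((inner ℝ (Complex.measurableEquivRealProd.symm p) t : ℝ)
      * Complex.I) = Complex.exp (t.re * p.1 * Complex.I) * Complex.exp (t.im * p.2 * Complex.I) := by
    intro p
    rw [← Complex.exp_add]
    congr 1
    have : (inner ℝ (Complex.measurableEquivRealProd.symm p) t : ℝ) = t.re * p.1 + t.im * p.2 := by
      rw [Complex.inner, Complex.measurableEquivRealProd_symm_apply]
      simp
    rw [this]
    push_cast
    ring
  simp_rw [h]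
  rw [integral_prod_mul (fun x : ℝ => Complex.exp (t.re * x * Complex.I))
    (fun x : ℝ => Complex.exp (t.im * x * Complex.I)), ← charFun_apply_real, ← charFun_apply_real,
    charFun_gaussianReal, charFun_gaussianReal, ← Complex.exp_add, ← Complex.normSq_eq_norm_sq,
    Complex.normSq_apply]
  congr 1
  push_cast
  ring

/-- The Gaussian integral is a complex square root of `1 / (1 - t * I)`. Its square, which is what
the real and imaginary parts together produce, is free of the choice of branch. -/
lemma integral_cexp_sq_gaussianReal (t : ℝ) :
    (∫ x : ℝ, Complex.exp (t * (x ^ 2 : ℝ) * Complex.I) ∂gaussianReal 0 (1 / 2)) ^ 2 =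
      1 / (1 - t * Complex.I) := by
  have hre : 0 < (1 - t * Complex.I : ℂ).re := by simp
  rw [integral_gaussianReal_eq_integral_smul (by simp)]
  have h : ∀ x : ℝ, gaussianPDFReal 0 (1 / 2) x • Complex.exp (t * (x ^ 2 : ℝ) * Complex.I) =
      ((Real.sqrt Real.pi)⁻¹ : ℝ) * Complex.exp (-(1 - t * Complex.I) * (x : ℂ) ^ 2) := fun x => by
    rw [gaussianPDFReal, Complex.real_smul, show -(1 - t * Complex.I) * (x : ℂ) ^ 2 =
      -x ^ 2 + t * x ^ 2 * Complex.I by ring, Complex.exp_add]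
    simp only [NNReal.coe_div, NNReal.coe_one, NNReal.coe_ofNat, sub_zero]
    rw [show 2 * Real.pi * (1 / 2) = Real.pi by ring, show -x ^ 2 / (2 * (1 / 2)) = -x ^ 2 by ring]
    push_cast
    ring
  simp_rw [h]
  have h0 : (1 - t * Complex.I : ℂ) ≠ 0 := fun h => by rw [h] at hre; simp at hre
  have hpi : (Real.pi : ℂ) ≠ 0 := by exact_mod_cast Real.pi_ne_zero
  rw [integral_const_mul, integral_gaussian_complex hre, mul_pow, ← Complex.ofReal_pow, inv_pow,
    Real.sq_sqrt Real.pi_pos.le, ← Complex.cpow_nat_mul]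
  simp only [Nat.cast_ofNat, one_div, ne_eq, OfNat.ofNat_ne_zero, not_false_eq_true,
    mul_inv_cancel₀, Complex.cpow_one, Complex.ofReal_inv]
  field_simp

lemma integral_cexp_norm_sq_stdComplexGaussian (t : ℝ) :
    ∫ z : ℂ, Complex.exp (t * (‖z‖ ^ 2 : ℝ) * Complex.I) ∂stdComplexGaussian =
      1 / (1 - t * Complex.I) := by
  rw [stdComplexGaussian_eq_map, integral_map_equiv]
  have h : ∀ p : ℝ × ℝ, Complex.exp (t * (‖Complex.measurableEquivRealProd.symm p‖ ^ 2 : ℝ)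
      * Complex.I) = Complex.exp (t * (p.1 ^ 2 : ℝ) * Complex.I) *
        Complex.exp (t * (p.2 ^ 2 : ℝ) * Complex.I) := by
    intro p
    rw [← Complex.exp_add, ← Complex.normSq_eq_norm_sq, Complex.normSq_apply,
      Complex.measurableEquivRealProd_symm_apply]
    congr 1
    push_cast
    ring
  simp_rw [h]
  rw [integral_prod_mul (fun x : ℝ => Complex.exp (t * (x ^ 2 : ℝ) * Complex.I))
    (fun x : ℝ => Complex.exp (t * (x ^ 2 : ℝ) * Complex.I)), ← sq, integral_cexp_sq_gaussianReal]

/-- The law of a vector with i.i.d. `CN(0,1)` entries. -/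
abbrev complexGaussian (ι : Type*) [Fintype ι] : Measure (ι → ℂ) :=
  Measure.pi fun _ => stdComplexGaussian

/-- Each squared modulus is exponential with characteristic function `1 / (1 - t * I)`, and
independence multiplies these. A general subset of the coordinates is allowed so that one of them
can be dropped for the zero-forcing gain. -/
lemma map_sum_norm_sq_complexGaussian {ι : Type*} [Fintype ι] [DecidableEq ι] (s : Finset ι)
    {k : ℕ} (hs : s.card = k + 1) :
    (complexGaussian ι).map (fun z => ∑ i ∈ s, ‖z i‖ ^ 2) = erlang k 1 := by
  have := isProbabilityMeasure_erlang k one_pos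
  have : IsProbabilityMeasure ((complexGaussian ι).map fun z => ∑ i ∈ s, ‖z i‖ ^ 2) :=
    Measure.isProbabilityMeasure_map (Measurable.aemeasurable (by fun_prop))
  refine Measure.ext_of_charFun (funext fun t => ?_)
  rw [charFun_apply_real, charFun_erlang k one_pos,
    integral_map (Measurable.aemeasurable (by fun_prop)) (by fun_prop)]
  have h : ∀ z : ι → ℂ, Complex.exp (t * (∑ i ∈ s, ‖z i‖ ^ 2 : ℝ) * Complex.I) =
      ∏ i, (if i ∈ s then Complex.exp (t * (‖z i‖ ^ 2 : ℝ) * Complex.I) else 1) := fun z => by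
    rw [Finset.prod_ite_mem, Finset.univ_inter, ← Complex.exp_sum]
    congr 1
    push_cast
    rw [Finset.mul_sum, Finset.sum_mul]
  simp_rw [h]
  rw [complexGaussian, integral_fintype_prod_eq_prod (f := fun i z =>
    if i ∈ s then Complex.exp (t * (‖z‖ ^ 2 : ℝ) * Complex.I) else 1)]
  have h2 : ∀ i, ∫ z : ℂ, (if i ∈ s then Complex.exp (t * (‖z‖ ^ 2 : ℝ) * Complex.I) else 1)
      ∂stdComplexGaussian = if i ∈ s then 1 / (1 - t * Complex.I) else 1 := fun i => by
    split_ifs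
    · exact integral_cexp_norm_sq_stdComplexGaussian t
    · simp
  simp_rw [h2]
  rw [Finset.prod_ite_mem, Finset.univ_inter, Finset.prod_const, hs]
  simp

lemma map_normSq_complexGaussian {N k : ℕ} (hN : N = k + 1) :
    (complexGaussian (Fin N)).map normSq = erlang k 1 :=
  map_sum_norm_sq_complexGaussian Finset.univ (by simpa using hN)

lemma measurable_normSq {N : ℕ} : Measurable (normSq : (Fin N → ℂ) → ℝ) := by
  unfold normSq; fun_prop

/-- Unitary invariance of the complex Gaussian law. -/
lemma map_repr_complexGaussian {ι : Type*} [Fintype ι]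
    (b : OrthonormalBasis ι ℂ (EuclideanSpace ℂ ι)) :
    ((complexGaussian ι).map (WithLp.toLp 2)).map b.repr =
      (complexGaussian ι).map (WithLp.toLp 2) := by
  have hm : Measurable b.repr := b.repr.continuous.measurable
  have h1 : IsProbabilityMeasure ((complexGaussian ι).map (WithLp.toLp 2)) :=
    Measure.isProbabilityMeasure_map (by fun_prop)
  have h2 : IsProbabilityMeasure (((complexGaussian ι).map (WithLp.toLp 2)).map b.repr) :=
    Measure.isProbabilityMeasure_map hm.aemeasurable
  have hinner : ∀ x t : EuclideanSpace ℂ ι, inner ℝ x t = (inner ℂ x t).re := fun x t => by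
    rw [PiLp.inner_apply, PiLp.inner_apply, Complex.re_sum]
    rfl
  -- The characteristic function depends on `t` only through its norm, which a unitary map
  -- preserves.
  have hchar : ∀ t, charFun ((complexGaussian ι).map (WithLp.toLp 2)) t =
      Complex.exp (-(‖t‖ ^ 2 / 4 : ℝ)) := fun t => by
    rw [complexGaussian, charFun_pi]
    simp_rw [charFun_stdComplexGaussian]
    rw [← Complex.exp_sum, EuclideanSpace.norm_sq_eq]
    push_cast
    rw [Finset.sum_neg_distrib, Finset.sum_div]
  refine Measure.ext_of_charFun (funext fun t => ?_)
  have h : charFun (((complexGaussian ι).map (WithLp.toLp 2)).map b.repr) t =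
      charFun ((complexGaussian ι).map (WithLp.toLp 2)) (b.repr.symm t) := by
    rw [charFun_apply, charFun_apply, integral_map hm.aemeasurable (by fun_prop)]
    refine integral_congr_ae (ae_of_all _ fun x => ?_)
    simp only [hinner]
    rw [← b.repr.inner_map_map x, b.repr.apply_symm_apply]
  rw [h, hchar, hchar, b.repr.symm.norm_map]

/-! ### The zero-forcing gain -/

lemma star_dotProduct_self_eq_normSq {N : ℕ} (v : Fin N → ℂ) :
    star v ⬝ᵥ v = (normSq v : ℂ) := by
  simp only [dotProduct, normSq, Pi.star_apply, RCLike.star_def]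
  push_cast
  refine Finset.sum_congr rfl fun i _ => ?_
  rw [mul_comm, Complex.mul_conj, Complex.normSq_eq_norm_sq]
  push_cast
  rfl

lemma zfProj_mulVec {N : ℕ} (hI v : Fin N → ℂ) :
    zfProj hI *ᵥ v = v - ((star hI ⬝ᵥ hI)⁻¹ * (star hI ⬝ᵥ v)) • hI := by
  rw [zfProj, sub_mulVec, one_mulVec, smul_mulVec, vecMulVec_mulVec]
  congr 1
  ext i
  simp [mul_assoc, mul_comm]

/-- No condition on `hI` is needed: for `hI = 0` the inverse is `0` and the projection is the
identity. -/
lemma star_dotProduct_zfProj_mulVec {N : ℕ} (hI v : Fin N → ℂ) :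
    star v ⬝ᵥ (zfProj hI *ᵥ v) =
      ((normSq v - (normSq hI)⁻¹ * ‖star hI ⬝ᵥ v‖ ^ 2 : ℝ) : ℂ) := by
  have h : star v ⬝ᵥ hI = star (star hI ⬝ᵥ v) := by
    rw [star_dotProduct]
  have h2 : (star hI ⬝ᵥ v) * star (star hI ⬝ᵥ v) = ((‖star hI ⬝ᵥ v‖ ^ 2 : ℝ) : ℂ) := by
    rw [RCLike.star_def, Complex.mul_conj, Complex.normSq_eq_norm_sq]
  rw [zfProj_mulVec, dotProduct_sub, dotProduct_smul, star_dotProduct_self_eq_normSq,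
    star_dotProduct_self_eq_normSq, h, smul_eq_mul, mul_assoc, h2]
  push_cast
  rfl

/-- In an orthonormal basis whose first vector is parallel to `hI`, the zero-forcing gain is the
squared norm of the remaining coordinates. -/
lemma exists_basis_zfGain_eq {N : ℕ} {hI : Fin N → ℂ} (h : hI ≠ 0) (i₀ : Fin N) :
    ∃ b : OrthonormalBasis (Fin N) ℂ (EuclideanSpace ℂ (Fin N)), ∀ v : Fin N → ℂ,
      zfGain v hI = ∑ i ∈ Finset.univ.erase i₀, ‖b.repr (WithLp.toLp 2 v) i‖ ^ 2 := by
  set w : EuclideanSpace ℂ (Fin N) := WithLp.toLp 2 hI with hw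
  have hw0 : w ≠ 0 := by simpa [hw] using h
  have hwn : ‖w‖ ≠ 0 := norm_ne_zero_iff.2 hw0
  set u : EuclideanSpace ℂ (Fin N) := ((‖w‖ : ℂ)⁻¹) • w with hu
  have hun : ‖u‖ = 1 := by
    rw [hu, norm_smul, norm_inv, Complex.norm_real, norm_norm, inv_mul_cancel₀ hwn]
  have ho : Orthonormal ℂ (({i₀} : Set (Fin N)).domRestrict fun _ => u) := by
    refine ⟨fun _ => hun, fun i j hij => (hij (Subsingleton.elim i j)).elim⟩
  obtain ⟨b, hb⟩ := ho.exists_orthonormalBasis_extension_of_card_eq (by simp)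
  have hb0 : b i₀ = u := hb i₀ rfl
  have hnw : normSq hI = ‖w‖ ^ 2 := by rw [EuclideanSpace.norm_sq_eq]; rfl
  refine ⟨b, fun v => ?_⟩
  have hsum : normSq v = ∑ i, ‖b.repr (WithLp.toLp 2 v) i‖ ^ 2 := by
    have h1 : normSq v = ‖(WithLp.toLp 2 v : EuclideanSpace ℂ (Fin N))‖ ^ 2 := by
      rw [EuclideanSpace.norm_sq_eq]; rfl
    rw [h1, ← b.repr.norm_map, EuclideanSpace.norm_sq_eq]
  have hcoord : ‖b.repr (WithLp.toLp 2 v) i₀‖ ^ 2 = (normSq hI)⁻¹ * ‖star hI ⬝ᵥ v‖ ^ 2 := by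
    rw [b.repr_apply_apply, hb0, hu, inner_smul_left, norm_mul, mul_pow, hnw,
      EuclideanSpace.inner_eq_star_dotProduct, dotProduct_comm]
    simp [hw]
  have hmain : normSq v - (normSq hI)⁻¹ * ‖star hI ⬝ᵥ v‖ ^ 2 =
      ∑ i ∈ Finset.univ.erase i₀, ‖b.repr (WithLp.toLp 2 v) i‖ ^ 2 := by
    rw [hsum, ← Finset.add_sum_erase _ _ (Finset.mem_univ i₀), hcoord]
    ring
  rw [zfGain, star_dotProduct_zfProj_mulVec, hmain, Complex.norm_real, Real.norm_of_nonneg]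
  positivity

/-- In a basis adapted to `hI` the gain is a sum of `N - 1 = k + 1` squared coordinates, and by
unitary invariance these coordinates are again i.i.d. Gaussian. -/
lemma map_zfGain_complexGaussian {N k : ℕ} (hN : N = k + 2) {hI : Fin N → ℂ} (h : hI ≠ 0) :
    (complexGaussian (Fin N)).map (fun v => zfGain v hI) = erlang k 1 := by
  obtain ⟨b, hb⟩ := exists_basis_zfGain_eq h ⟨0, by omega⟩
  have hm : Measurable b.repr := b.repr.continuous.measurable
  have hs : (Finset.univ.erase (⟨0, by omega⟩ : Fin N)).card = k + 1 := by
    rw [Finset.card_erase_of_mem (Finset.mem_univ _), Finset.card_univ, Fintype.card_fin, hN]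
    rfl
  rw [← map_sum_norm_sq_complexGaussian _ hs, funext hb]
  set f : EuclideanSpace ℂ (Fin N) → ℝ := fun x =>
    ∑ i ∈ Finset.univ.erase (⟨0, by omega⟩ : Fin N), ‖x i‖ ^ 2 with hf
  have hfm : Measurable f := by rw [hf]; fun_prop
  have h1 := congrArg (Measure.map f) (map_repr_complexGaussian b)
  rw [Measure.map_map hfm hm, Measure.map_map (hfm.comp hm) (by fun_prop),
    Measure.map_map hfm (by fun_prop)] at h1
  exact h1

lemma measurable_zfGain {N : ℕ} :
    Measurable fun p : (Fin N → ℂ) × (Fin N → ℂ) => zfGain p.1 p.2 := by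
  have h : ∀ p : (Fin N → ℂ) × (Fin N → ℂ), zfGain p.1 p.2 =
      |normSq p.1 - (normSq p.2)⁻¹ * ‖∑ i, star (p.2 i) * p.1 i‖ ^ 2| := fun p => by
    rw [zfGain, star_dotProduct_zfProj_mulVec, Complex.norm_real, Real.norm_eq_abs]
    rfl
  simp_rw [h]
  have := measurable_normSq (N := N)
  fun_prop

lemma ae_complexGaussian_ne_zero {N : ℕ} (hN : 0 < N) :
    ∀ᵐ v ∂complexGaussian (Fin N), 0 < normSq v := by
  obtain ⟨k, rfl⟩ : ∃ k, N = k + 1 := ⟨N - 1, by omega⟩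
  refine ae_of_ae_map measurable_normSq.aemeasurable (p := fun t => 0 < t) ?_
  rw [map_normSq_complexGaussian rfl]
  exact ae_erlang_pos k 1

/-- The conditional law given the interferer is the same for almost every value of the latter, so it
is also the unconditional law. -/
lemma map_zfGain_prod {N k : ℕ} (hN : N = k + 2) :
    ((complexGaussian (Fin N)).prod (complexGaussian (Fin N))).map
      (fun p => zfGain p.1 p.2) = erlang k 1 := by
  refine Measure.ext fun B hB => ?_
  rw [Measure.map_apply measurable_zfGain hB,
    Measure.prod_apply_symm (measurable_zfGain hB)]
  have h : ∀ᵐ w ∂complexGaussian (Fin N), complexGaussian (Fin N)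
      ((fun v => (v, w)) ⁻¹' ((fun p => zfGain p.1 p.2) ⁻¹' B)) = erlang k 1 B := by
    filter_upwards [ae_complexGaussian_ne_zero (N := N) (by omega)] with w hw
    have hw0 : w ≠ 0 := by rintro rfl; simp [normSq] at hw
    have hm : Measurable fun v => zfGain v w := Measurable.comp
      (g := fun p : (Fin N → ℂ) × (Fin N → ℂ) => zfGain p.1 p.2) (f := fun v => (v, w))
      measurable_zfGain (measurable_id.prodMk measurable_const)
    have h1 := Measure.map_apply (μ := complexGaussian (Fin N)) hm hB
    rw [map_zfGain_complexGaussian hN hw0] at h1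
    exact h1.symm
  rw [lintegral_congr_ae h]
  simp

/-! ### Laws under Rayleigh fading -/

variable {Ω : Type*} [MeasurableSpace Ω] {μ : Measure Ω} {N : ℕ} {h₁ hI h₂ : Ω → Fin N → ℂ}

lemma IsRayleigh.hasLaw (h : IsRayleigh μ h₁ hI h₂) :
    HasLaw (fun ω => (h₁ ω, hI ω, h₂ ω))
      ((complexGaussian (Fin N)).prod
        ((complexGaussian (Fin N)).prod (complexGaussian (Fin N)))) μ := by
  have hpi := h.indep.hasLaw_pi (μ := fun _ => stdComplexGaussian)
    (by rintro (i | i | i); exacts [h.law₁ i, h.lawI i, h.law₂ i])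
  have e1 := (measurePreserving_sumPiEquivProdPi
    (fun _ : Fin N ⊕ Fin N ⊕ Fin N => stdComplexGaussian))
  have e2 := (measurePreserving_sumPiEquivProdPi
    (fun _ : Fin N ⊕ Fin N => stdComplexGaussian))
  exact (((MeasurePreserving.id _).prod e2).comp e1).comp_hasLaw hpi

lemma IsRayleigh.hasLaw_normSq (h : IsRayleigh μ h₁ hI h₂) {k : ℕ} (hN : N = k + 1) :
    HasLaw (fun ω => (normSq (h₁ ω), normSq (hI ω), normSq (h₂ ω)))
      ((erlang k 1).prod ((erlang k 1).prod (erlang k 1))) μ := by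
  have e : MeasurePreserving normSq (complexGaussian (Fin N)) (erlang k 1) :=
    ⟨measurable_normSq, map_normSq_complexGaussian hN⟩
  have := isProbabilityMeasure_erlang k one_pos
  exact (e.prod (e.prod e)).comp_hasLaw h.hasLaw

lemma IsRayleigh.hasLaw_zfGain (h : IsRayleigh μ h₁ hI h₂) {k : ℕ} (hN : N = k + 2) :
    HasLaw (fun ω => zfGain (h₁ ω) (hI ω)) (erlang k 1) μ := by
  have e : MeasurePreserving (fun p : (Fin N → ℂ) × (Fin N → ℂ) => zfGain p.1 p.2)
      ((complexGaussian (Fin N)).prod (complexGaussian (Fin N))) (erlang k 1) :=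
    ⟨measurable_zfGain, map_zfGain_prod hN⟩
  have e2 := (MeasurePreserving.id (complexGaussian (Fin N))).prod
    (measurePreserving_fst (μ := complexGaussian (Fin N)) (ν := complexGaussian (Fin N)))
  exact (e.comp e2).comp_hasLaw h.hasLaw

/-! ### Partial fractions -/

/-- The principal part at `D = 0` of `D ^ (-a) * (D + δ) ^ (-b)`. -/
def principalPart (a b : ℕ) (D δ : ℂ) : ℂ :=
  ∑ k ∈ Finset.range a, (-1) ^ k * (b.multichoose k : ℂ) * δ⁻¹ ^ (b + k) * D⁻¹ ^ (a - k)

/-- With `E = D + δ`, writing `δ = E - D` gives this recursion for the product of inverse powers; on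
the coefficients it is Pascal's rule for `multichoose`. -/
lemma mul_principalPart_succ_succ (a b : ℕ) (D : ℂ) {δ : ℂ} (hδ : δ ≠ 0) :
    δ * principalPart (a + 1) (b + 1) D δ =
      principalPart (a + 1) b D δ - principalPart a (b + 1) D δ := by
  simp only [principalPart]
  rw [Finset.sum_range_succ' _ a, Finset.sum_range_succ' _ a, mul_add, Finset.mul_sum,
    add_sub_right_comm, ← Finset.sum_sub_distrib]
  congr 1
  · refine Finset.sum_congr rfl fun k _ => ?_
    rw [Nat.multichoose_succ_succ, show a + 1 - (k + 1) = a - k by omega]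
    push_cast
    rw [show b + 1 + (k + 1) = (b + 1 + k) + 1 by ring, show b + (k + 1) = b + 1 + k by ring,
      pow_succ δ⁻¹ (b + 1 + k)]
    field_simp
    ring
  · simp only [pow_zero, Nat.multichoose_zero_right, Nat.cast_one, add_zero, mul_one, one_mul,
      pow_succ]
    field_simp

lemma principalPart_zero_right (a : ℕ) (D δ : ℂ) :
    principalPart (a + 1) 0 D δ = D⁻¹ ^ (a + 1) := by
  rw [principalPart, Finset.sum_range_succ']
  simp

/-- Induction on the total exponent. When both exponents are positive, both sides obey the recursion
obtained by multiplying with `E - D`, and this factor can be cancelled. When one is zero, a single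
pure power remains. -/
lemma inv_pow_mul_inv_pow_eq_principalPart {D E : ℂ} (hD : D ≠ 0) (hE : E ≠ 0) (hDE : D ≠ E)
    (n : ℕ) : ∀ a b : ℕ, a + b = n + 1 →
    D⁻¹ ^ a * E⁻¹ ^ b = principalPart a b D (E - D) + principalPart b a E (D - E) := by
  have h1 : E - D ≠ 0 := sub_ne_zero.2 hDE.symm
  have h2 : D - E ≠ 0 := sub_ne_zero.2 hDE
  have hz : ∀ b D δ, principalPart 0 b D δ = 0 := fun b D δ => by simp [principalPart]
  induction n with
  | zero =>
    rintro (_ | a) (_ | b) h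
    · simp at h
    · rw [hz, principalPart_zero_right]; simp
    · rw [hz, principalPart_zero_right]; simp
    · omega
  | succ n ih =>
    rintro (_ | a) (_ | b) h
    · simp at h
    · rw [hz, principalPart_zero_right]; simp
    · rw [hz, principalPart_zero_right]; simp
    · have i1 := ih (a + 1) b (by omega)
      have i2 := ih a (b + 1) (by omega)
      have m1 := mul_principalPart_succ_succ a b D h1
      have m2 := mul_principalPart_succ_succ b a E h2
      refine mul_left_cancel₀ h1 ?_
      have e : (E - D) * (D⁻¹ ^ (a + 1) * E⁻¹ ^ (b + 1)) =
          D⁻¹ ^ (a + 1) * E⁻¹ ^ b - D⁻¹ ^ a * E⁻¹ ^ (b + 1) := by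
        rw [pow_succ, pow_succ]; field_simp
      linear_combination e + i1 - i2 - m1 + m2

/-! ### The density of a sum of two gamma variables -/

/-- The candidate density `p` is a signed combination whose positivity is not evident. With `P` and
`M` the measures given by its positive and negative parts, uniqueness of characteristic functions
gives `ν + M = P`, from which integrals against `ν` are read off. -/
lemma integral_eq_setIntegral_mul_of_charFun_eq {ν : Measure ℝ} [IsFiniteMeasure ν] {p : ℝ → ℝ}
    (hpm : Measurable p) (hp : IntegrableOn p (Ioi 0))
    (hchar : ∀ t : ℝ, charFun ν t = ∫ x in Ioi (0 : ℝ), p x • Complex.exp (t * x * Complex.I))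
    {f : ℝ → ℝ} (hfm : Measurable f) (hf : IntegrableOn (fun x => p x * f x) (Ioi 0)) :
    Integrable f ν ∧ ∫ x, f x ∂ν = ∫ x in Ioi (0 : ℝ), p x * f x := by
  set P : Measure ℝ := (volume.restrict (Ioi 0)).withDensity fun x => ENNReal.ofReal (p x) with hP
  set M : Measure ℝ := (volume.restrict (Ioi 0)).withDensity fun x => ENNReal.ofReal (-p x)
    with hM
  have hPf : IsFiniteMeasure P := isFiniteMeasure_withDensity_ofReal hp.2
  have hMf : IsFiniteMeasure M := isFiniteMeasure_withDensity_ofReal hp.neg.2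
  have hm1 : Measurable fun x => ENNReal.ofReal (p x) := by fun_prop
  have hm2 : Measurable fun x => ENNReal.ofReal (-p x) := by fun_prop
  have hlt : ∀ q : ℝ → ℝ, ∀ᵐ x ∂volume.restrict (Ioi (0 : ℝ)), ENNReal.ofReal (q x) < ⊤ :=
    fun q => ae_of_all _ fun _ => ENNReal.ofReal_lt_top
  have hdiff : ∀ x, (ENNReal.ofReal (p x)).toReal - (ENNReal.ofReal (-p x)).toReal = p x :=
    fun x => by
    rw [ENNReal.toReal_ofReal', ENNReal.toReal_ofReal']
    rcases le_total 0 (p x) with h | h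
    · rw [max_eq_left h, max_eq_right (by linarith), sub_zero]
    · rw [max_eq_right h, max_eq_left (by linarith)]; ring
  have habs : ∀ x, (ENNReal.ofReal (p x)).toReal ≤ |p x| := fun x => by
    rw [ENNReal.toReal_ofReal']; exact max_le (le_abs_self _) (abs_nonneg _)
  have habs2 : ∀ x, (ENNReal.ofReal (-p x)).toReal ≤ |p x| := fun x => by
    rw [ENNReal.toReal_ofReal']; exact max_le (neg_le_abs _) (abs_nonneg _)
  have hcexp : ∀ (t : ℝ) (Q : Measure ℝ) [IsFiniteMeasure Q],
      Integrable (fun x : ℝ => Complex.exp (t * x * Complex.I)) Q := fun t Q _ => by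
    refine (integrable_const (1 : ℝ)).mono' (by fun_prop) (ae_of_all _ fun x => ?_)
    rw [← Complex.ofReal_mul, Complex.norm_exp_ofReal_mul_I]
  have hkey : ν + M = P := by
    refine Measure.ext_of_charFun (funext fun t => ?_)
    have e1 : charFun (ν + M) t = charFun ν t + charFun M t := by
      rw [charFun_apply_real, charFun_apply_real, charFun_apply_real,
        integral_add_measure (hcexp t ν) (hcexp t M)]
    rw [e1, hchar, charFun_apply_real, charFun_apply_real, ← eq_sub_iff_add_eq, hP, hM,
      integral_withDensity_eq_integral_toReal_smul hm1 (hlt _),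
      integral_withDensity_eq_integral_toReal_smul hm2 (hlt _), ← integral_sub]
    · refine integral_congr_ae (ae_of_all _ fun x => ?_)
      simp only
      rw [← sub_smul, hdiff]
    · exact (integrable_withDensity_iff_integrable_smul' hm1 (hlt _)).1 (hcexp t P)
    · exact (integrable_withDensity_iff_integrable_smul' hm2 (hlt _)).1 (hcexp t M)
  have hfP : Integrable f P := by
    rw [hP, integrable_withDensity_iff_integrable_smul' hm1 (hlt _)]
    refine hf.norm.mono' (by fun_prop) (ae_of_all _ fun x => ?_)
    rw [smul_eq_mul, norm_mul, norm_mul, Real.norm_of_nonneg ENNReal.toReal_nonneg]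
    exact mul_le_mul_of_nonneg_right (habs x) (norm_nonneg _)
  have hfνM : Integrable f (ν + M) := by rw [hkey]; exact hfP
  rw [integrable_add_measure] at hfνM
  refine ⟨hfνM.1, ?_⟩
  have e := integral_add_measure hfνM.1 hfνM.2
  rw [hkey] at e
  rw [← sub_eq_iff_eq_add.2 e, hP, hM, integral_withDensity_eq_integral_toReal_smul hm1 (hlt _),
    integral_withDensity_eq_integral_toReal_smul hm2 (hlt _), ← integral_sub]
  · refine integral_congr_ae (ae_of_all _ fun x => ?_)
    simp only
    rw [← sub_smul, hdiff, smul_eq_mul]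
  · exact (integrable_withDensity_iff_integrable_smul' hm1 (hlt _)).1 hfP
  · exact (integrable_withDensity_iff_integrable_smul' hm2 (hlt _)).1 hfνM.2

/-- The coefficient of `(p + x) ^ (-(N - k))` in the partial fraction expansion of
`(p + x) ^ (-N) * (p + y) ^ (-N)`. -/
def pfCoeff (N k : ℕ) (x y : ℝ) : ℝ :=
  (-1) ^ k * (N.multichoose k : ℝ) * (y - x)⁻¹ ^ (N + k)

/-- The part at the rate `x` of the density of the sum of gamma variables of shape `N` and rates
`x` and `y`, up to the factor `x ^ N * y ^ N`. -/
def erlPart (N : ℕ) (x y t : ℝ) : ℝ :=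
  ∑ k ∈ Finset.range N, pfCoeff N k x y * erl (N - 1 - k) x t

lemma measurable_erlPart (N : ℕ) (x y : ℝ) : Measurable (erlPart N x y) := by
  unfold erlPart
  have := fun k => (continuous_erl k x).measurable
  fun_prop

lemma integrableOn_smul_erlPart {E : Type*} [NormedAddCommGroup E] [NormedSpace ℝ E] (N : ℕ)
    (x y : ℝ) {f : ℝ → E} (hf : ∀ k, IntegrableOn (fun t => erl k x t • f t) (Ioi 0)) :
    IntegrableOn (fun t => erlPart N x y t • f t) (Ioi 0) ∧
      ∫ t in Ioi (0 : ℝ), erlPart N x y t • f t =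
        ∑ k ∈ Finset.range N, pfCoeff N k x y • ∫ t in Ioi (0 : ℝ), erl (N - 1 - k) x t • f t := by
  have hi : ∀ k ∈ Finset.range N, IntegrableOn
      (fun t => pfCoeff N k x y • (erl (N - 1 - k) x t • f t)) (Ioi 0) :=
    fun k _ => (hf (N - 1 - k)).smul _
  have he : ∀ t, erlPart N x y t • f t =
      ∑ k ∈ Finset.range N, pfCoeff N k x y • (erl (N - 1 - k) x t • f t) := fun t => by
    rw [erlPart, Finset.sum_smul]
    simp_rw [mul_smul]
  simp_rw [he]
  refine ⟨integrable_finsetSum _ hi, ?_⟩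
  rw [integral_finsetSum _ hi]
  simp_rw [integral_smul]

/-- Each term `erl j x` transforms to the pole `(x - t * I) ^ (-(j + 1))`. The difference of the two
poles, `y - x`, does not involve `t`, so the partial fraction coefficients are constants. -/
lemma integral_erlPart_smul_cexp {N : ℕ} {x : ℝ} (hx : 0 < x) (y t : ℝ) :
    IntegrableOn (fun s : ℝ => erlPart N x y s • Complex.exp (t * s * Complex.I)) (Ioi 0) ∧
    ∫ s in Ioi (0 : ℝ), erlPart N x y s • Complex.exp (t * s * Complex.I) =
      principalPart N N (x - t * Complex.I) (y - x) := by
  have hi : ∀ k, IntegrableOn (fun s : ℝ => erl k x s • Complex.exp (t * s * Complex.I)) (Ioi 0) :=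
    fun k => by
    have := (continuous_erl k x).measurable
    refine (integrableOn_erl k hx).norm.mono' (by fun_prop) (ae_of_all _ fun s => ?_)
    rw [norm_smul, ← Complex.ofReal_mul, Complex.norm_exp_ofReal_mul_I, mul_one]
  obtain ⟨h1, h2⟩ := integrableOn_smul_erlPart N x y hi
  refine ⟨h1, ?_⟩
  rw [h2, principalPart]
  refine Finset.sum_congr rfl fun k hk => ?_
  rw [Finset.mem_range] at hk
  rw [integral_erl_mul_cexp _ hx, pfCoeff, Complex.real_smul,
    show N - 1 - k + 1 = N - k by omega, one_div, inv_pow (_ - _ : ℂ) (N - k)]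
  push_cast
  ring

/-- Expectations for the sum of two independent gamma variables of the same integer shape and
distinct rates. -/
lemma integral_erlang_conv_erlang (n : ℕ) {x y : ℝ} (hx : 0 < x) (hy : 0 < y) (hxy : x ≠ y)
    {f : ℝ → ℝ} (hfm : Measurable f) (hfx : ∀ k, IntegrableOn (fun t => f t * erl k x t) (Ioi 0))
    (hfy : ∀ k, IntegrableOn (fun t => f t * erl k y t) (Ioi 0)) :
    Integrable f (erlang n x ∗ erlang n y) ∧
      ∫ t, f t ∂(erlang n x ∗ erlang n y) = x ^ (n + 1) * y ^ (n + 1) *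
        ((∑ k ∈ Finset.range (n + 1), pfCoeff (n + 1) k x y *
            ∫ t in Ioi (0 : ℝ), f t * erl (n - k) x t) +
          ∑ k ∈ Finset.range (n + 1), pfCoeff (n + 1) k y x *
            ∫ t in Ioi (0 : ℝ), f t * erl (n - k) y t) := by
  have := isProbabilityMeasure_erlang n hx
  have := isProbabilityMeasure_erlang n hy
  set N := n + 1 with hN
  have hfx' : ∀ k, IntegrableOn (fun t => erl k x t • f t) (Ioi 0) := fun k => by
    simpa [mul_comm] using hfx k
  have hfy' : ∀ k, IntegrableOn (fun t => erl k y t • f t) (Ioi 0) := fun k => by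
    simpa [mul_comm] using hfy k
  obtain ⟨ax, bx⟩ := integrableOn_smul_erlPart N x y hfx'
  obtain ⟨ay, byy⟩ := integrableOn_smul_erlPart N y x hfy'
  have h1x := (integrableOn_smul_erlPart N x y (f := fun _ => (1 : ℝ))
    (fun k => by simpa using integrableOn_erl k hx)).1
  have h1y := (integrableOn_smul_erlPart N y x (f := fun _ => (1 : ℝ))
    (fun k => by simpa using integrableOn_erl k hy)).1
  simp only [smul_eq_mul, mul_one] at h1x h1y
  set p : ℝ → ℝ := fun t => x ^ N * y ^ N * (erlPart N x y t + erlPart N y x t) with hp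
  have hpm : Measurable p := by
    have := measurable_erlPart N x y
    have := measurable_erlPart N y x
    fun_prop
  have hpi : IntegrableOn p (Ioi 0) := (h1x.add h1y).const_mul _
  have hpf : ∀ t, p t * f t =
      x ^ N * y ^ N * (erlPart N x y t • f t + erlPart N y x t • f t) := fun t => by
    simp only [hp, smul_eq_mul]; ring
  have hchar : ∀ t : ℝ, charFun (erlang n x ∗ erlang n y) t =
      ∫ s in Ioi (0 : ℝ), p s • Complex.exp (t * s * Complex.I) := fun t => by
    obtain ⟨c1, d1⟩ := integral_erlPart_smul_cexp (N := N) hx y t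
    obtain ⟨c2, d2⟩ := integral_erlPart_smul_cexp (N := N) hy x t
    have he : ∀ s : ℝ, p s • Complex.exp (t * s * Complex.I) =
        (x ^ N * y ^ N) • (erlPart N x y s • Complex.exp (t * s * Complex.I) +
          erlPart N y x s • Complex.exp (t * s * Complex.I)) := fun s => by
      simp only [hp]
      rw [mul_smul, add_smul]
    simp_rw [he]
    rw [integral_smul, integral_add c1 c2, d1, d2, charFun_conv, charFun_erlang n hx,
      charFun_erlang n hy]
    have hne : ∀ r : ℝ, 0 < r → (r - t * Complex.I : ℂ) ≠ 0 := fun r hr h => by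
      have := congrArg Complex.re h
      simp at this
      exact hr.ne' this
    have hd : (x - t * Complex.I : ℂ) ≠ y - t * Complex.I := fun h => by
      rw [sub_left_inj] at h
      exact hxy (by exact_mod_cast h)
    have hpp := inv_pow_mul_inv_pow_eq_principalPart (hne x hx) (hne y hy) hd (N + n) N N
      (by omega)
    rw [sub_sub_sub_cancel_right, sub_sub_sub_cancel_right] at hpp
    rw [← hpp, Complex.real_smul, div_eq_mul_inv, div_eq_mul_inv, mul_pow, mul_pow]
    push_cast
    ring
  obtain ⟨r1, r2⟩ := integral_eq_setIntegral_mul_of_charFun_eq hpm hpi hchar hfm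
    (by simp_rw [hpf]; exact (ax.add ay).const_mul _)
  refine ⟨r1, ?_⟩
  rw [r2]
  simp_rw [hpf]
  rw [integral_const_mul, integral_add ax ay, bx, byy]
  simp only [smul_eq_mul, hN, Nat.add_sub_cancel, mul_comm (f _)]

/-- The `k` factors are `-N, ..., -(N + k - 1)`: a sign times a rising factorial. -/
lemma prod_one_sub_sub_div_factorial (N k : ℕ) :
    (∏ j ∈ Finset.Icc 1 k, (1 - (N : ℝ) - j)) / k.factorial = (-1) ^ k * (N.multichoose k : ℝ) := by
  have h : (∏ j ∈ Finset.Icc 1 k, (1 - (N : ℝ) - j)) = (-1) ^ k * (N.ascFactorial k : ℝ) := by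
    induction k with
    | zero => simp
    | succ k ih =>
      rw [Finset.prod_Icc_succ_top (by omega), ih, Nat.ascFactorial_succ]
      push_cast
      ring
  have h2 : N.ascFactorial k = k.factorial * N.multichoose k := by
    rw [Nat.multichoose_eq, Nat.ascFactorial_eq_factorial_mul_choose']
  rw [h, h2]
  push_cast
  field_simp

lemma pfCoeff_eq (N : ℕ) {s : ℕ} (hs : 1 ≤ s) (x y : ℝ) :
    pfCoeff N (s - 1) x y =
      (∏ j ∈ Finset.Icc 1 (s - 1), (1 - (N : ℝ) - j)) / (s - 1).factorial *
        (y - x) ^ (1 - (N : ℤ) - s) := by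
  rw [prod_one_sub_sub_div_factorial, pfCoeff]
  congr 1
  rw [show 1 - (N : ℤ) - s = -((N + (s - 1) : ℕ) : ℤ) by omega, _root_.zpow_neg, zpow_natCast, inv_pow]

lemma sum_Icc_eq_sum_range {M : Type*} [AddCommMonoid M] (f : ℕ → M) (N : ℕ) :
    ∑ s ∈ Finset.Icc 1 N, f s = ∑ k ∈ Finset.range N, f (k + 1) := by
  induction N with
  | zero => simp
  | succ n ih => rw [Finset.sum_Icc_succ_top (by omega), ih, Finset.sum_range_succ]

/-! ### The signal-to-noise ratio of the zero-forcing scheme -/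

lemma normSq_smul {N : ℕ} (a : ℂ) (v : Fin N → ℂ) : normSq (a • v) = ‖a‖ ^ 2 * normSq v := by
  simp [normSq, mul_pow, Finset.mul_sum]

lemma normSq_star {N : ℕ} (v : Fin N → ℂ) : normSq (star v) = normSq v := by
  simp [normSq]

lemma normSq_nonneg {N : ℕ} (v : Fin N → ℂ) : 0 ≤ normSq v := by
  unfold normSq; positivity

lemma dotProduct_star_self_eq_normSq {N : ℕ} (v : Fin N → ℂ) : v ⬝ᵥ star v = (normSq v : ℂ) := by
  rw [dotProduct_comm, star_dotProduct_self_eq_normSq]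

lemma normSq_ne_zero {N : ℕ} {v : Fin N → ℂ} (h : v ≠ 0) : normSq v ≠ 0 := by
  intro h0
  have := (Finset.sum_eq_zero_iff_of_nonneg (fun i _ => by positivity)).1 h0
  exact h (funext fun i => by simpa using this i (Finset.mem_univ i))

lemma zfProj_mulVec_self {N : ℕ} {hI : Fin N → ℂ} (h : hI ≠ 0) : zfProj hI *ᵥ hI = 0 := by
  rw [zfProj_mulVec, star_dotProduct_self_eq_normSq,
    inv_mul_cancel₀ (by exact_mod_cast normSq_ne_zero h), one_smul, sub_self]

lemma zfProj_conjTranspose {N : ℕ} (hI : Fin N → ℂ) : (zfProj hI)ᴴ = zfProj hI := by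
  rw [zfProj, conjTranspose_sub, conjTranspose_one, conjTranspose_smul, conjTranspose_vecMulVec,
    star_star, star_inv₀, star_dotProduct_self_eq_normSq]
  congr 3
  simp

lemma zfProj_mulVec_mulVec {N : ℕ} {hI : Fin N → ℂ} (h : hI ≠ 0) (v : Fin N → ℂ) :
    zfProj hI *ᵥ (zfProj hI *ᵥ v) = zfProj hI *ᵥ v := by
  conv_lhs => rw [zfProj_mulVec hI v, mulVec_sub, mulVec_smul, zfProj_mulVec_self h]
  simp

lemma star_vecMul_zfProj {N : ℕ} (h₁ hI : Fin N → ℂ) :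
    star h₁ ᵥ* zfProj hI = star (zfProj hI *ᵥ h₁) := by
  rw [star_mulVec, zfProj_conjTranspose]

/-- The projection is Hermitian and idempotent, so the quadratic form is a squared norm. This makes
the normalised combiner a unit vector. -/
lemma star_dotProduct_zfProj_mulVec_eq {N : ℕ} {h₁ hI : Fin N → ℂ} (h : hI ≠ 0) :
    star h₁ ⬝ᵥ (zfProj hI *ᵥ h₁) = (normSq (zfProj hI *ᵥ h₁) : ℂ) := by
  rw [← star_dotProduct_self_eq_normSq, ← star_vecMul_zfProj, ← dotProduct_mulVec,
    zfProj_mulVec_mulVec h]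

lemma zfGain_eq_normSq {N : ℕ} {h₁ hI : Fin N → ℂ} (h : hI ≠ 0) :
    zfGain h₁ hI = normSq (zfProj hI *ᵥ h₁) := by
  rw [zfGain, star_dotProduct_zfProj_mulVec_eq h, Complex.norm_real,
    Real.norm_of_nonneg (normSq_nonneg _)]

lemma zfCombiner_dotProduct_interferer {N : ℕ} {h₁ hI : Fin N → ℂ} (h : hI ≠ 0) :
    zfCombiner h₁ hI ⬝ᵥ hI = 0 := by
  rw [zfCombiner, smul_dotProduct, ← dotProduct_mulVec, zfProj_mulVec_self h]
  simp

lemma norm_zfCombiner_dotProduct_sq {N : ℕ} {h₁ hI : Fin N → ℂ} (hg : 0 < zfGain h₁ hI) :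
    ‖zfCombiner h₁ hI ⬝ᵥ h₁‖ ^ 2 = zfGain h₁ hI := by
  rw [zfCombiner, smul_dotProduct, ← dotProduct_mulVec, smul_eq_mul, norm_mul, norm_inv,
    Complex.norm_real, Real.norm_of_nonneg (Real.sqrt_nonneg _), mul_pow, inv_pow,
    Real.sq_sqrt hg.le, ← zfGain]
  field_simp

lemma normSq_zfCombiner {N : ℕ} {h₁ hI : Fin N → ℂ} (h : hI ≠ 0) (hg : 0 < zfGain h₁ hI) :
    normSq (zfCombiner h₁ hI) = 1 := by
  rw [zfCombiner, normSq_smul, star_vecMul_zfProj, normSq_star, ← zfGain_eq_normSq h, norm_inv,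
    Complex.norm_real, Real.norm_of_nonneg (Real.sqrt_nonneg _), inv_pow, Real.sq_sqrt hg.le,
    inv_mul_cancel₀ hg.ne']

lemma norm_inv_sqrt_sq {a : ℝ} (ha : 0 < a) : ‖((Real.sqrt a : ℂ)⁻¹)‖ ^ 2 = a⁻¹ := by
  rw [norm_inv, Complex.norm_real, Real.norm_of_nonneg (Real.sqrt_nonneg _), inv_pow,
    Real.sq_sqrt ha.le]

lemma zfDirection_mulVec {N : ℕ} (h₁ hI h₂ v : Fin N → ℂ) :
    zfDirection h₁ hI h₂ *ᵥ v =
      ((Real.sqrt (normSq h₂) : ℂ)⁻¹ * (zfCombiner h₁ hI ⬝ᵥ v)) • star h₂ := by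
  rw [zfDirection, smul_mulVec, vecMulVec_mulVec, mul_smul]
  congr 1
  ext i
  simp [mul_comm]

lemma normSq_zfDirection_mulVec {N : ℕ} {h₁ hI h₂ : Fin N → ℂ} (h2 : 0 < normSq h₂)
    (v : Fin N → ℂ) :
    normSq (zfDirection h₁ hI h₂ *ᵥ v) = ‖zfCombiner h₁ hI ⬝ᵥ v‖ ^ 2 := by
  rw [zfDirection_mulVec, normSq_smul, normSq_star, norm_mul, mul_pow, norm_inv_sqrt_sq h2]
  field_simp

lemma norm_dotProduct_zfDirection_mulVec_sq {N : ℕ} {h₁ hI h₂ : Fin N → ℂ} (h2 : 0 < normSq h₂)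
    (v : Fin N → ℂ) :
    ‖h₂ ⬝ᵥ (zfDirection h₁ hI h₂ *ᵥ v)‖ ^ 2 = normSq h₂ * ‖zfCombiner h₁ hI ⬝ᵥ v‖ ^ 2 := by
  rw [zfDirection_mulVec, dotProduct_smul, dotProduct_star_self_eq_normSq, smul_eq_mul, norm_mul,
    norm_mul, mul_pow, mul_pow, norm_inv_sqrt_sq h2, Complex.norm_real,
    Real.norm_of_nonneg h2.le]
  field_simp

lemma normSq_vecMul_zfDirection {N : ℕ} {h₁ hI h₂ : Fin N → ℂ} (h2 : 0 < normSq h₂) :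
    normSq (h₂ ᵥ* zfDirection h₁ hI h₂) = normSq h₂ * normSq (zfCombiner h₁ hI) := by
  rw [zfDirection, vecMul_smul, vecMul_vecMulVec, dotProduct_star_self_eq_normSq, normSq_smul,
    normSq_smul, norm_inv_sqrt_sq h2, Complex.norm_real, Real.norm_of_nonneg h2.le]
  field_simp

lemma sum_norm_zfDirection_sq {N : ℕ} {h₁ hI h₂ : Fin N → ℂ} (h2 : 0 < normSq h₂) :
    ∑ i, ∑ j, ‖zfDirection h₁ hI h₂ i j‖ ^ 2 = normSq (zfCombiner h₁ hI) := by
  have h : ∀ i j, ‖zfDirection h₁ hI h₂ i j‖ ^ 2 =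
      (normSq h₂)⁻¹ * (‖h₂ i‖ ^ 2 * ‖zfCombiner h₁ hI j‖ ^ 2) := fun i j => by
    rw [zfDirection, Matrix.smul_apply, vecMulVec_apply, smul_eq_mul, norm_mul, norm_mul, mul_pow, mul_pow,
      norm_inv_sqrt_sq h2, Pi.star_apply, norm_star]
  simp_rw [h, ← Finset.mul_sum]
  rw [← Finset.sum_mul]
  change (normSq h₂)⁻¹ * (normSq h₂ * normSq (zfCombiner h₁ hI)) = _
  field_simp

namespace Params

variable {S : Params}

lemma Valid.link_pos (hS : S.Valid) : 0 < S.ρ₁ / S.d₁ ^ S.τ ∧ 0 < S.ρI / S.dI ^ S.τ ∧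
    0 < S.η * S.θ / S.d₂ ^ S.τ ∧ 0 < (1 - S.θ) * S.ρ₁ / S.d₁ ^ S.τ := by
  have h1 := Real.rpow_pos_of_pos hS.d₁_pos S.τ
  have h2 := Real.rpow_pos_of_pos hS.dI_pos S.τ
  have h3 := Real.rpow_pos_of_pos hS.d₂_pos S.τ
  have h4 : 0 < S.ρ₁ := div_pos hS.Ps_pos hS.N₀_pos
  have h5 : 0 < S.ρI := div_pos hS.PI_pos hS.N₀_pos
  have h6 := hS.η_pos
  have h7 := hS.θ_pos
  have h8 : 0 < 1 - S.θ := by linarith [hS.θ_lt_one]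
  exact ⟨by positivity, by positivity, by positivity, by positivity⟩

/-- The end-to-end ratio in terms of the ratios of the two hops. -/
lemma gammaZF_eq (hS : S.Valid) {N : ℕ} {h₁ hI h₂ : Fin N → ℂ} (hI0 : hI ≠ 0)
    (hg : 0 < zfGain h₁ hI) (h2 : 0 < normSq h₂) :
    S.gammaZF h₁ hI h₂ = S.gammaZF₁ h₁ hI * S.gamma₂ h₁ hI h₂ /
      (1 + S.gammaZF₁ h₁ hI + S.gamma₂ h₁ hI h₂) := by
  have p1 := Real.rpow_pos_of_pos hS.d₁_pos S.τ
  have pI := Real.rpow_pos_of_pos hS.dI_pos S.τ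
  have p2 := Real.rpow_pos_of_pos hS.d₂_pos S.τ
  have hPs := hS.Ps_pos
  have hPI := hS.PI_pos
  have hN0 := hS.N₀_pos
  have hη := hS.η_pos
  have hθ := hS.θ_pos
  have hθ' : 0 < 1 - S.θ := by linarith [hS.θ_lt_one]
  have n1 := normSq_nonneg h₁
  have nI := normSq_nonneg hI
  -- Before scaling, the relay transmits the signal gain and the noise of a unit combiner; the
  -- interference term is nulled.
  have hT : S.transmitPower h₁ hI (zfDirection h₁ hI h₂) =
      (1 - S.θ) * S.Ps / S.d₁ ^ S.τ * zfGain h₁ hI + S.N₀ := by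
    rw [transmitPower, normSq_zfDirection_mulVec h2, normSq_zfDirection_mulVec h2,
      sum_norm_zfDirection_sq h2, zfCombiner_dotProduct_interferer hI0,
      norm_zfCombiner_dotProduct_sq hg, normSq_zfCombiner hI0 hg]
    simp
  have hω : ‖(S.zfScale h₁ hI h₂ : ℂ)‖ ^ 2 = S.relayPower h₁ hI /
      ((1 - S.θ) * S.Ps / S.d₁ ^ S.τ * zfGain h₁ hI + S.N₀) := by
    have hR : 0 ≤ S.relayPower h₁ hI := by rw [relayPower]; positivity
    rw [Complex.norm_real, zfScale, Real.norm_of_nonneg (Real.sqrt_nonneg _), hT,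
      Real.sq_sqrt (by positivity)]
  rw [gammaZF, sinr, zfMatrix, smul_mulVec, smul_mulVec, vecMul_smul, dotProduct_smul,
    dotProduct_smul, normSq_smul, smul_eq_mul, smul_eq_mul, norm_mul, norm_mul, mul_pow, mul_pow,
    norm_dotProduct_zfDirection_mulVec_sq h2, norm_dotProduct_zfDirection_mulVec_sq h2,
    normSq_vecMul_zfDirection h2, zfCombiner_dotProduct_interferer hI0,
    norm_zfCombiner_dotProduct_sq hg, normSq_zfCombiner hI0 hg, hω, relayPower, gammaZF₁, gamma₂,
    ρ₁, ρI]
  simp only [norm_zero, ne_eq, OfNat.ofNat_ne_zero, not_false_eq_true, zero_pow, mul_zero, zero_add,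
    mul_one]
  -- What remains is an identity of rational functions in positive quantities, so the powers and
  -- norms become plain variables.
  generalize S.d₁ ^ S.τ = e₁ at *
  generalize S.dI ^ S.τ = eI at *
  generalize S.d₂ ^ S.τ = e₂ at *
  generalize zfGain h₁ hI = g at *
  generalize normSq h₂ = m at *
  generalize normSq h₁ = a at *
  generalize normSq hI = b at *
  generalize 1 - S.θ = q at *
  rw [div_eq_div_iff (by positivity) (by positivity)]
  field_simp
  ring

end Params

lemma one_add_mul_div_one_add_add {a b : ℝ} (ha : 0 ≤ a) (hb : 0 ≤ b) :
    1 + a * b / (1 + a + b) = (1 + a) * (1 + b) / (1 + a + b) := by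
  have : 0 < 1 + a + b := by positivity
  field_simp
  ring

/-! ### Jensen's inequality for `log (1 + exp u + exp v)` -/

/-- The left side is the tangent plane at `(u, v)` of the convex function whose value at `(log X,
log Y)` is the right side. The inequality is Gibbs' inequality for the probability vectors
proportional to `(1, exp u, exp v)` and `(1, X, Y)`. -/
lemma log_one_add_exp_add_exp_tangent (u v : ℝ) {X Y : ℝ} (hX : 0 < X) (hY : 0 < Y) :
    Real.log (1 + Real.exp u + Real.exp v)
      + Real.exp u / (1 + Real.exp u + Real.exp v) * (Real.log X - u)
      + Real.exp v / (1 + Real.exp u + Real.exp v) * (Real.log Y - v) ≤ Real.log (1 + X + Y) := by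
  set a := Real.exp u with ha
  set b := Real.exp v with hb
  have ha0 : 0 < a := Real.exp_pos u
  have hb0 : 0 < b := Real.exp_pos v
  have hS : 0 < 1 + a + b := by positivity
  have hT : 0 < 1 + X + Y := by positivity
  have la : Real.log a = u := Real.log_exp u
  have lb : Real.log b = v := Real.log_exp v
  set s := 1 + a + b with hs
  set T := 1 + X + Y with hTd
  -- Apply `log r ≤ r - 1` to the three ratios of corresponding probabilities, then average with
  -- weights `a / s`, `b / s`, `1 / s`; the right sides cancel because both vectors have total mass
  -- `1`.
  have i1 := Real.log_le_sub_one_of_pos (show 0 < X * s / (a * T) by positivity)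
  have i2 := Real.log_le_sub_one_of_pos (show 0 < Y * s / (b * T) by positivity)
  have i3 := Real.log_le_sub_one_of_pos (show 0 < s / T by positivity)
  rw [Real.log_div (by positivity) (by positivity), Real.log_mul hX.ne' hS.ne',
    Real.log_mul ha0.ne' hT.ne', la] at i1
  rw [Real.log_div (by positivity) (by positivity), Real.log_mul hY.ne' hS.ne',
    Real.log_mul hb0.ne' hT.ne', lb] at i2
  rw [Real.log_div hS.ne' hT.ne'] at i3
  have j1 := mul_le_mul_of_nonneg_left i1 (show 0 ≤ a / s by positivity)
  have j2 := mul_le_mul_of_nonneg_left i2 (show 0 ≤ b / s by positivity)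
  have j3 := mul_le_mul_of_nonneg_left i3 (show 0 ≤ 1 / s by positivity)
  have e1 : a / s * (X * s / (a * T) - 1) + b / s * (Y * s / (b * T) - 1)
      + 1 / s * (s / T - 1) = 0 := by
    have : a / s * (X * s / (a * T) - 1) + b / s * (Y * s / (b * T) - 1)
      + 1 / s * (s / T - 1) = (1 + X + Y) / T - (1 + a + b) / s := by field_simp; ring
    rw [this, ← hs, ← hTd, div_self hT.ne', div_self hS.ne', sub_self]
  have e2 : a / s + b / s + 1 / s = 1 := by
    rw [← add_div, ← add_div, div_eq_one_iff_eq hS.ne', hs]; ring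
  linear_combination j1 + j2 + j3 + e1 + (Real.log T - Real.log s) * e2

/-- With the tangent plane taken at the means of `log X` and `log Y`, its linear terms integrate to
zero. The joint law is irrelevant. -/
lemma log_one_add_exp_integral_le {Ω : Type*} [MeasurableSpace Ω] {μ : Measure Ω}
    [IsProbabilityMeasure μ] {X Y : Ω → ℝ} (hX : ∀ᵐ ω ∂μ, 0 < X ω) (hY : ∀ᵐ ω ∂μ, 0 < Y ω)
    (hXi : Integrable (fun ω => Real.log (X ω)) μ) (hYi : Integrable (fun ω => Real.log (Y ω)) μ)
    (hXY : Integrable (fun ω => Real.log (1 + X ω + Y ω)) μ) :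
    Real.log (1 + Real.exp (∫ ω, Real.log (X ω) ∂μ) + Real.exp (∫ ω, Real.log (Y ω) ∂μ)) ≤
      ∫ ω, Real.log (1 + X ω + Y ω) ∂μ := by
  set u := ∫ ω, Real.log (X ω) ∂μ with hu
  set v := ∫ ω, Real.log (Y ω) ∂μ with hv
  set p := Real.exp u / (1 + Real.exp u + Real.exp v)
  set q := Real.exp v / (1 + Real.exp u + Real.exp v)
  have h0 : Integrable (fun ω => p * (Real.log (X ω) - u)) μ :=
    (hXi.sub (integrable_const _)).const_mul _
  have h1 : Integrable (fun ω => Real.log (1 + Real.exp u + Real.exp v)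
      + p * (Real.log (X ω) - u)) μ :=
    (integrable_const _).add h0
  have h2 : Integrable (fun ω => q * (Real.log (Y ω) - v)) μ :=
    (hYi.sub (integrable_const _)).const_mul _
  have h := integral_mono_ae (h1.add h2) hXY (by
    filter_upwards [hX, hY] with ω hx hy using log_one_add_exp_add_exp_tangent u v hx hy)
  simp only [Pi.add_apply] at h
  rw [integral_add h1 h2, integral_add (integrable_const _) h0,
    integral_const_mul, integral_const_mul,
    integral_sub hXi (integrable_const _), integral_sub hYi (integrable_const _)] at h
  simpa [← hu, ← hv] using h

/-! ### Integrals against gamma laws -/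

lemma integrable_id_erlang (k : ℕ) {r : ℝ} (hr : 0 < r) : Integrable (fun t => t) (erlang k r) := by
  rw [integrable_erlang_iff k hr]
  refine ((integrableOn_erl (k + 1) hr).const_mul ((k : ℝ) + 1)).congr (ae_of_all _ fun t => ?_)
  simp only [smul_eq_mul]
  rw [← id_mul_erl, mul_comm]

lemma integrable_log_erlang (k : ℕ) {r : ℝ} (hr : 0 < r) : Integrable Real.log (erlang k r) := by
  rw [integrable_erlang_iff k hr]
  simpa [mul_comm] using integrableOn_log_mul_erl k hr

lemma integral_log_erlang_one (k : ℕ) : ∫ t, Real.log t ∂erlang k 1 = psi (k + 1) := by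
  rw [integral_erlang k one_pos]
  simpa [mul_comm] using integral_log_mul_erl k one_pos

lemma integrable_log_one_add_mul_erlang (k : ℕ) {c r : ℝ} (hc : 0 ≤ c) (hr : 0 < r) :
    Integrable (fun t => Real.log (1 + c * t)) (erlang k r) := by
  rw [integrable_erlang_iff k hr]
  simpa [mul_comm] using integrableOn_log_one_add_mul_erl k hc hr

lemma integral_log_one_add_mul_erlang (k : ℕ) (c : ℝ) :
    ∫ t, Real.log (1 + c * t) ∂erlang k 1 =
      ∫ x in Ioi (0 : ℝ), Real.log (1 + c * x) * erl k 1 x := by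
  rw [integral_erlang k one_pos]
  simp [mul_comm]

/-! ### The sum of two gamma variables -/

lemma logSum₂_eq (N : ℕ) (x y : ℝ) :
    Params.logSum₂ N x y = y ^ N * ∑ k ∈ Finset.range N, pfCoeff N k x y * x ^ k *
      (psi ((N - 1 - k : ℕ) + 1) - Real.log x) := by
  rw [Params.logSum₂, sum_Icc_eq_sum_range]
  congr 1
  refine Finset.sum_congr rfl fun k hk => ?_
  rw [Finset.mem_range] at hk
  rw [← pfCoeff_eq N (by omega), Nat.add_sub_cancel]
  congr 2
  · rw [show 1 - ((k + 1 : ℕ) : ℤ) = -(k : ℤ) by push_cast; ring, _root_.zpow_neg, zpow_natCast,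
      inv_pow, inv_inv]
  · congr 1
    rw [Nat.cast_sub (by omega), Nat.cast_sub (by omega)]
    push_cast
    ring

lemma integral_log_erlang_conv_erlang (n : ℕ) {x y : ℝ} (hx : 0 < x) (hy : 0 < y) (hxy : x ≠ y) :
    Integrable Real.log (erlang n x ∗ erlang n y) ∧
      ∫ t, Real.log t ∂(erlang n x ∗ erlang n y) =
        Params.logSum₂ (n + 1) x y + Params.logSum₂ (n + 1) y x := by
  obtain ⟨h1, h2⟩ := integral_erlang_conv_erlang n hx hy hxy Real.measurable_log
    (fun k => integrableOn_log_mul_erl k hx) (fun k => integrableOn_log_mul_erl k hy)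
  refine ⟨h1, ?_⟩
  rw [h2, mul_add, logSum₂_eq, logSum₂_eq, Finset.mul_sum, Finset.mul_sum,
    Finset.mul_sum, Finset.mul_sum]
  have key : ∀ {u : ℝ} (_ : 0 < u) (v : ℝ) {k : ℕ} (_ : k ∈ Finset.range (n + 1)),
      u ^ (n + 1) * v ^ (n + 1) * (pfCoeff (n + 1) k u v *
        ∫ t in Ioi (0 : ℝ), Real.log t * erl (n - k) u t) =
      v ^ (n + 1) * (pfCoeff (n + 1) k u v * u ^ k *
        (psi ((n + 1 - 1 - k : ℕ) + 1) - Real.log u)) := by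
    intro u hu v k hk
    rw [Finset.mem_range] at hk
    -- Of the prefactor `u ^ (n + 1)`, the moment of shape `n - k + 1` cancels all but `u ^ k`.
    have hp : u ^ (n + 1) = u ^ k * u ^ (n - k + 1) := by rw [← pow_add]; congr 1; omega
    rw [integral_log_mul_erl _ hu, hp, Nat.add_sub_cancel]
    field_simp
  congr 1
  · exact Finset.sum_congr rfl fun k hk => key hx y hk
  · refine Finset.sum_congr rfl fun k hk => ?_
    rw [← key hy x hk]
    ring

/-- The expectation of `log (1 + c a X)` for `X` of the gamma law of shape `n + 1`. -/
lemma integral_log_one_add_erlang_eq_sum (n : ℕ) {c a : ℝ} (hc : 0 ≤ c) (ha : 0 ≤ a) :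
    ∫ t, Real.log (1 + c * a * t) ∂erlang n 1 =
      ∑ m ∈ Finset.range (n + 1), c * a * invGamma m (c * a) := by
  rw [integral_log_one_add_mul_erlang, integral_log_one_add_mul_erl n (mul_nonneg hc ha)]
  simp_rw [integral_div_one_add_mul_erl]

/-- Substitute `s = c t`. The extra factor `c t` raises the exponent to `j + 1 ≥ 1`, the range in
which the Mellin inversion above applies. -/
lemma integral_mul_invGamma_mul_erl (m j : ℕ) {c : ℝ} (hc : 0 < c) {x : ℝ} (hx : 0 < x) :
    IntegrableOn (fun t => c * t * invGamma m (c * t) * erl j x t) (Ioi 0) ∧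
      ∫ t in Ioi (0 : ℝ), c * t * invGamma m (c * t) * erl j x t =
        c⁻¹ ^ (j + 1) / j.factorial * laplaceInvGamma (j + 1) m (x * c⁻¹) := by
  have he : ∀ t : ℝ, c * t * invGamma m (c * t) * erl j x t = c⁻¹ ^ j / j.factorial *
      (fun s => s ^ (j + 1) * invGamma m s * Real.exp (-(x * c⁻¹ * s))) (c * t) := fun t => by
    simp only [erl]
    rw [show x * c⁻¹ * (c * t) = x * t by field_simp, mul_pow, inv_pow]
    field_simp
    ring
  simp_rw [he]
  constructor
  · refine Integrable.const_mul ?_ _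
    have h := (integrableOn_Ioi_comp_mul_left_iff (fun s =>
      s ^ (j + 1) * invGamma m s * Real.exp (-(x * c⁻¹ * s))) 0 hc).2
    rw [mul_zero] at h
    exact h (integrableOn_pow_mul_invGamma_mul_exp _ _ (by positivity))
  · have h := integral_comp_mul_left_Ioi (fun s =>
      s ^ (j + 1) * invGamma m s * Real.exp (-(x * c⁻¹ * s))) 0 hc
    rw [mul_zero] at h
    rw [integral_const_mul, h, laplaceInvGamma, smul_eq_mul]
    ring

/-- The real form of one of the two sums in the closed form of `C_{γ_{I2}}`. -/
def capSumReal (N : ℕ) (κ x y : ℝ) : ℝ :=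
  ∑ k ∈ Finset.range N, pfCoeff N k x y * ∑ m ∈ Finset.range N,
    κ ^ (N - k) / (N - 1 - k).factorial * laplaceInvGamma (N - k) m (x * κ)

lemma capSum₂_eq {S : Params} (hS : S.Valid) (N : ℕ) {x : ℝ} (hx : 0 < x) (y : ℝ) :
    S.capSum₂ N x y = (capSumReal N (S.d₂ ^ S.τ / (S.η * S.θ)) x y : ℂ) := by
  have hκ : 0 < S.d₂ ^ S.τ / (S.η * S.θ) := by
    have h3 := Real.rpow_pos_of_pos hS.d₂_pos S.τ
    have h6 := hS.η_pos
    have h7 := hS.θ_pos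
    positivity
  rw [Params.capSum₂, sum_Icc_eq_sum_range, capSumReal, Complex.ofReal_sum, mul_div_assoc]
  generalize S.d₂ ^ S.τ / (S.η * S.θ) = κ at hκ
  refine Finset.sum_congr rfl fun k hk => ?_
  rw [Finset.mem_range] at hk
  rw [Complex.ofReal_mul (pfCoeff N k x y), Complex.ofReal_sum, Finset.mul_sum, Finset.mul_sum]
  refine Finset.sum_congr rfl fun m _ => ?_
  -- With `s = k + 1` the Meijer parameters are those of the Laplace transform with exponent `n = N
  -- - k`; the `1 / m!` of the formula cancels the `m!` of the kernel.
  have e1 : ((k + 1 : ℕ) : ℝ) - N - 1 = -((N - k : ℕ) : ℝ) := by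
    rw [Nat.cast_sub hk.le]; push_cast; ring
  have e2 : (m : ℝ) + (k + 1 : ℕ) - N - 1 = (m : ℝ) - ((N - k : ℕ) : ℝ) := by
    rw [Nat.cast_sub hk.le]; push_cast; ring
  have hm : (m.factorial : ℂ) ≠ 0 := by exact_mod_cast m.factorial_ne_zero
  have hc := pfCoeff_eq N (s := k + 1) (by omega) x y
  rw [e1, e2, meijerG_eq_laplaceInvGamma (by omega) (by positivity),
    show N + 1 - (k + 1) = N - k by omega, show N - (k + 1) = N - 1 - k by omega]
  rw [Nat.add_sub_cancel] at hc ⊢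
  rw [hc]
  push_cast
  field_simp

lemma integral_log_one_add_erlang_conv_erlang (n : ℕ) {c x y : ℝ} (hc : 0 < c) (hx : 0 < x)
    (hy : 0 < y) (hxy : x ≠ y) (hpos : ∀ᵐ a ∂(erlang n x ∗ erlang n y), 0 < a) :
    ∫ a, (∫ t, Real.log (1 + c * a * t) ∂erlang n 1) ∂(erlang n x ∗ erlang n y) =
      x ^ (n + 1) * y ^ (n + 1) *
        (capSumReal (n + 1) c⁻¹ x y + capSumReal (n + 1) c⁻¹ y x) := by
  have hm := measurable_invGamma
  set f : ℝ → ℝ := fun a => ∑ m ∈ Finset.range (n + 1), c * a * invGamma m (c * a) with hf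
  have hfm : Measurable f := by rw [hf]; fun_prop
  have hcong : ∫ a, (∫ t, Real.log (1 + c * a * t) ∂erlang n 1) ∂(erlang n x ∗ erlang n y) =
      ∫ a, f a ∂(erlang n x ∗ erlang n y) := by
    refine integral_congr_ae ?_
    -- Integration by parts in the inner variable needs `c * a ≥ 0`, hence the positivity of `a`
    -- almost everywhere.
    filter_upwards [hpos] with a ha using integral_log_one_add_erlang_eq_sum n hc.le ha.le
  have hfi : ∀ {u : ℝ}, 0 < u → ∀ j, IntegrableOn (fun t => f t * erl j u t) (Ioi 0) ∧
      ∫ t in Ioi (0 : ℝ), f t * erl j u t = ∑ m ∈ Finset.range (n + 1),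
        c⁻¹ ^ (j + 1) / j.factorial * laplaceInvGamma (j + 1) m (u * c⁻¹) := by
    intro u hu j
    have he : ∀ t, f t * erl j u t =
        ∑ m ∈ Finset.range (n + 1), c * t * invGamma m (c * t) * erl j u t := fun t => by
      rw [hf, Finset.sum_mul]
    simp_rw [he]
    have hi := fun m (_ : m ∈ Finset.range (n + 1)) =>
      (integral_mul_invGamma_mul_erl m j hc hu).1
    refine ⟨integrable_finsetSum _ hi, ?_⟩
    rw [integral_finsetSum _ hi]
    exact Finset.sum_congr rfl fun m _ => (integral_mul_invGamma_mul_erl m j hc hu).2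
  rw [hcong, (integral_erlang_conv_erlang n hx hy hxy hfm (fun j => (hfi hx j).1)
    (fun j => (hfi hy j).1)).2, capSumReal, capSumReal]
  congr 2
  · refine Finset.sum_congr rfl fun k hk => ?_
    rw [Finset.mem_range] at hk
    rw [(hfi hx _).2, Nat.add_sub_cancel, show n + 1 - k = n - k + 1 by omega]
  · refine Finset.sum_congr rfl fun k hk => ?_
    rw [Finset.mem_range] at hk
    rw [(hfi hy _).2, Nat.add_sub_cancel, show n + 1 - k = n - k + 1 by omega]

/-! ### Laws of the two hops -/

section Laws

variable {Ω : Type*} [MeasurableSpace Ω] {μ : Measure Ω} {N : ℕ} {h₁ hI h₂ : Ω → Fin N → ℂ}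

/-- Scaling a gamma variable by `a` turns rate `1` into rate `a⁻¹`. The product form records that
the harvested power is independent of the relay-destination channel. -/
lemma IsRayleigh.hasLaw_harvest (h : IsRayleigh μ h₁ hI h₂) {n : ℕ} (hN : N = n + 1) {a b : ℝ}
    (ha : 0 < a) (hb : 0 < b) :
    HasLaw (fun ω => (a * normSq (h₁ ω) + b * normSq (hI ω), normSq (h₂ ω)))
      ((erlang n a⁻¹ ∗ erlang n b⁻¹).prod (erlang n 1)) μ := by
  have := isProbabilityMeasure_erlang n one_pos
  have := isProbabilityMeasure_erlang n (inv_pos.2 ha)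
  have := isProbabilityMeasure_erlang n (inv_pos.2 hb)
  have hs : ∀ {r : ℝ}, 0 < r →
      MeasurePreserving (fun t => r * t) (erlang n 1) (erlang n r⁻¹) := fun {r} hr =>
    ⟨by fun_prop, by simpa using erlang_map_mul n (inv_pos.2 hr)⟩
  have e1 := (hs ha).prod ((hs hb).prod (MeasurePreserving.id (erlang n 1)))
  have e2 := (measurePreserving_prodAssoc (erlang n a⁻¹) (erlang n b⁻¹) (erlang n 1)).symm
  have e3 : MeasurePreserving (fun p : ℝ × ℝ => p.1 + p.2)
      ((erlang n a⁻¹).prod (erlang n b⁻¹)) (erlang n a⁻¹ ∗ erlang n b⁻¹) :=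
    ⟨by fun_prop, rfl⟩
  exact ((e3.prod (MeasurePreserving.id (erlang n 1))).comp (e2.comp e1)).comp_hasLaw
    (h.hasLaw_normSq hN)

lemma IsRayleigh.ae_pos (h : IsRayleigh μ h₁ hI h₂) (hN : 1 < N) :
    ∀ᵐ ω ∂μ, 0 < normSq (h₁ ω) ∧ 0 < normSq (hI ω) ∧ 0 < normSq (h₂ ω) ∧
      0 < zfGain (h₁ ω) (hI ω) := by
  obtain ⟨k, rfl⟩ : ∃ k, N = k + 2 := ⟨N - 2, by omega⟩
  have := isProbabilityMeasure_erlang (k + 1) one_pos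
  have h1 := h.hasLaw_normSq rfl
  have l1 := measurePreserving_fst.comp_hasLaw h1
  have l2 := (measurePreserving_fst.comp measurePreserving_snd).comp_hasLaw h1
  have l3 := (measurePreserving_snd.comp measurePreserving_snd).comp_hasLaw h1
  have hm : Measurable fun t : ℝ => 0 < t := measurableSet_setOfPred.1 measurableSet_Ioi
  filter_upwards [(l1.ae_iff hm).2 (ae_erlang_pos _ _), (l2.ae_iff hm).2 (ae_erlang_pos _ _),
    (l3.ae_iff hm).2 (ae_erlang_pos _ _), ((h.hasLaw_zfGain rfl).ae_iff hm).2 (ae_erlang_pos _ _)]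
    with ω a b c d using ⟨a, b, c, d⟩

end Laws

lemma integrable_comp_of_hasLaw {Ω 𝓧 : Type*} [MeasurableSpace Ω] [MeasurableSpace 𝓧]
    {μ : Measure Ω} {ν : Measure 𝓧} {X : Ω → 𝓧} (hX : HasLaw X ν μ) {f : 𝓧 → ℝ}
    (hf : Integrable f ν) : Integrable (fun ω => f (X ω)) μ := by
  rw [← hX.map_eq] at hf
  exact hf.comp_aemeasurable hX.aemeasurable

section Hops

variable {Ω : Type*} [MeasurableSpace Ω] {μ : Measure Ω} {N : ℕ}
  {S : Params} {h₁ hI h₂ : Ω → Fin N → ℂ}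

/-! ### The first hop -/

lemma IsRayleigh.integral_log_one_add_gammaZF₁ (h : IsRayleigh μ h₁ hI h₂)
    (hN : 1 < N) (hS : S.Valid) :
    Integrable (fun ω => Real.log (1 + S.gammaZF₁ (h₁ ω) (hI ω))) μ ∧
      ergodicCapacity μ (fun ω => S.gammaZF₁ (h₁ ω) (hI ω)) = S.capFormula₁ N := by
  obtain ⟨k, rfl⟩ : ∃ k, N = k + 2 := ⟨N - 2, by omega⟩
  have hc := hS.link_pos.2.2.2
  have hl := h.hasLaw_zfGain rfl
  have hi := integrable_log_one_add_mul_erlang k hc.le one_pos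
  have he : ∀ ω, S.gammaZF₁ (h₁ ω) (hI ω) =
      (1 - S.θ) * S.ρ₁ / S.d₁ ^ S.τ * zfGain (h₁ ω) (hI ω) := fun ω => by
    rw [Params.gammaZF₁, mul_comm]
  have hint : ∫ ω, Real.log (1 + S.gammaZF₁ (h₁ ω) (hI ω)) ∂μ =
      ∫ t, Real.log (1 + (1 - S.θ) * S.ρ₁ / S.d₁ ^ S.τ * t) ∂erlang k 1 := by
    simp_rw [he]
    exact hl.integral_comp hi.aestronglyMeasurable
  constructor
  · simp_rw [he]
    exact integrable_comp_of_hasLaw hl hi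
  · rw [ergodicCapacity, Params.capFormula₁]
    simp_rw [Real.logb]
    rw [integral_div, hint, integral_log_one_add_mul_erlang,
      integral_log_one_add_mul_erl_eq_upperGamma k hc, inv_div, show k + 2 - 1 = k + 1 by omega]
    ring

lemma IsRayleigh.integral_log_gammaZF₁ [IsProbabilityMeasure μ] (h : IsRayleigh μ h₁ hI h₂)
    (hN : 1 < N) (hS : S.Valid) :
    Integrable (fun ω => Real.log (S.gammaZF₁ (h₁ ω) (hI ω))) μ ∧
      ∫ ω, Real.log (S.gammaZF₁ (h₁ ω) (hI ω)) ∂μ = S.logFormula₁ N := by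
  have hpos := h.ae_pos hN
  obtain ⟨k, rfl⟩ : ∃ k, N = k + 2 := ⟨N - 2, by omega⟩
  have hc := hS.link_pos.2.2.2
  have hl := h.hasLaw_zfGain rfl
  have hi := integrable_comp_of_hasLaw hl (integrable_log_erlang k one_pos)
  have he : (fun ω => Real.log (S.gammaZF₁ (h₁ ω) (hI ω))) =ᵐ[μ] fun ω =>
      Real.log (zfGain (h₁ ω) (hI ω)) + Real.log ((1 - S.θ) * S.ρ₁ / S.d₁ ^ S.τ) := by
    filter_upwards [hpos] with ω hω
    rw [Params.gammaZF₁, Real.log_mul hω.2.2.2.ne' hc.ne']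
  refine ⟨(hi.add (integrable_const _)).congr he.symm, ?_⟩
  have h0 := Real.rpow_pos_of_pos hS.d₁_pos S.τ
  have hne : (1 - S.θ) * S.ρ₁ ≠ 0 := fun h => by rw [h, zero_div] at hc; exact hc.false
  have hlog : ∫ ω, Real.log (zfGain (h₁ ω) (hI ω)) ∂μ = psi (k + 1) := by
    rw [← integral_log_erlang_one]
    exact hl.integral_comp (integrable_log_erlang k one_pos).aestronglyMeasurable
  rw [integral_congr_ae he, integral_add hi (integrable_const _), hlog, integral_const,
    Params.logFormula₁, Real.log_div hne h0.ne']
  simp only [probReal_univ, one_smul]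
  push_cast
  rw [show (k : ℝ) + 2 - 1 = k + 1 by ring]
  ring

/-! ### The second hop -/

lemma gamma₂_eq (S : Params) (a b c : Fin N → ℂ) : S.gamma₂ a b c =
    S.η * S.θ / S.d₂ ^ S.τ * (S.ρ₁ / S.d₁ ^ S.τ * normSq a + S.ρI / S.dI ^ S.τ * normSq b)
      * normSq c := rfl

/-- The logarithm turns the product into a sum, so only the marginal laws enter. Distinct link
strengths give distinct rates, as the partial fractions require. -/
lemma IsRayleigh.integral_log_gamma₂ [IsProbabilityMeasure μ] (h : IsRayleigh μ h₁ hI h₂)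
    (hN : 1 < N) (hS : S.Valid) (hne : S.ρ₁ / S.d₁ ^ S.τ ≠ S.ρI / S.dI ^ S.τ) :
    Integrable (fun ω => Real.log (S.gamma₂ (h₁ ω) (hI ω) (h₂ ω))) μ ∧
      ∫ ω, Real.log (S.gamma₂ (h₁ ω) (hI ω) (h₂ ω)) ∂μ = S.logFormula₂ N := by
  have hpos := h.ae_pos hN
  obtain ⟨n, rfl⟩ : ∃ n, N = n + 1 := ⟨N - 1, by omega⟩
  obtain ⟨ha, hb, hc, -⟩ := hS.link_pos
  have hl := h.hasLaw_harvest rfl ha hb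
  have p0 := isProbabilityMeasure_erlang n one_pos
  have p1 := isProbabilityMeasure_erlang n (inv_pos.2 ha)
  have p2 := isProbabilityMeasure_erlang n (inv_pos.2 hb)
  have lA := measurePreserving_fst.comp_hasLaw hl
  have lX := measurePreserving_snd.comp_hasLaw hl
  obtain ⟨iA, eA⟩ := integral_log_erlang_conv_erlang n (inv_pos.2 ha) (inv_pos.2 hb)
    (fun he => hne (inv_injective he))
  have iX := integrable_log_erlang n one_pos
  have jA := integrable_comp_of_hasLaw lA iA
  have jX := integrable_comp_of_hasLaw lX iX
  have kA := lA.integral_comp iA.aestronglyMeasurable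
  have kX := lX.integral_comp iX.aestronglyMeasurable
  rw [eA] at kA
  rw [integral_log_erlang_one] at kX
  simp only [Function.comp_def] at jA jX kA kX
  have he : (fun ω => Real.log (S.gamma₂ (h₁ ω) (hI ω) (h₂ ω))) =ᵐ[μ] fun ω =>
      Real.log (S.η * S.θ / S.d₂ ^ S.τ)
        + Real.log (S.ρ₁ / S.d₁ ^ S.τ * normSq (h₁ ω) + S.ρI / S.dI ^ S.τ * normSq (hI ω))
        + Real.log (normSq (h₂ ω)) := by
    filter_upwards [hpos] with ω ⟨q1, q2, q3, _⟩
    have hA : 0 < S.ρ₁ / S.d₁ ^ S.τ * normSq (h₁ ω) + S.ρI / S.dI ^ S.τ * normSq (hI ω) := by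
      positivity
    rw [gamma₂_eq, Real.log_mul (by positivity) q3.ne', Real.log_mul hc.ne' hA.ne']
  have i0 : Integrable (fun _ : Ω => Real.log (S.η * S.θ / S.d₂ ^ S.τ)) μ := integrable_const _
  have i0A : Integrable (fun ω => Real.log (S.η * S.θ / S.d₂ ^ S.τ)
    + Real.log (S.ρ₁ / S.d₁ ^ S.τ * normSq (h₁ ω) + S.ρI / S.dI ^ S.τ * normSq (hI ω))) μ :=
    i0.add jA
  refine ⟨(i0A.add jX).congr he.symm, ?_⟩
  have h0 := Real.rpow_pos_of_pos hS.d₂_pos S.τ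
  rw [integral_congr_ae he, integral_add i0A jX, integral_add i0 jA, kA, kX,
    integral_const, Params.logFormula₂,
    Real.log_div (mul_pos hS.η_pos hS.θ_pos).ne' h0.ne', inv_div, inv_div]
  simp only [probReal_univ, one_smul]
  push_cast
  ring

/-- Here independence matters: integrate first over the gamma variable of the second link, then over
the harvested power. -/
lemma IsRayleigh.integral_log_one_add_gamma₂ (h : IsRayleigh μ h₁ hI h₂)
    (hN : 1 < N) (hS : S.Valid) (hne : S.ρ₁ / S.d₁ ^ S.τ ≠ S.ρI / S.dI ^ S.τ) :
    Integrable (fun ω => Real.log (1 + S.gamma₂ (h₁ ω) (hI ω) (h₂ ω))) μ ∧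
      ((ergodicCapacity μ (fun ω => S.gamma₂ (h₁ ω) (hI ω) (h₂ ω)) : ℝ) : ℂ) =
        S.capFormula₂ N := by
  have hpos := h.ae_pos hN
  obtain ⟨n, rfl⟩ : ∃ n, N = n + 1 := ⟨N - 1, by omega⟩
  obtain ⟨ha, hb, hc, -⟩ := hS.link_pos
  have hl := h.hasLaw_harvest rfl ha hb
  have p0 := isProbabilityMeasure_erlang n one_pos
  have p1 := isProbabilityMeasure_erlang n (inv_pos.2 ha)
  have p2 := isProbabilityMeasure_erlang n (inv_pos.2 hb)
  have lA := measurePreserving_fst.comp_hasLaw hl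
  have hxy : (S.ρ₁ / S.d₁ ^ S.τ)⁻¹ ≠ (S.ρI / S.dI ^ S.τ)⁻¹ := fun he => hne (inv_injective he)
  have hA0 : ∀ᵐ a ∂(erlang n (S.ρ₁ / S.d₁ ^ S.τ)⁻¹ ∗ erlang n (S.ρI / S.dI ^ S.τ)⁻¹),
      0 < a := by
    refine (lA.ae_iff (measurableSet_setOfPred.1 measurableSet_Ioi)).1 ?_
    filter_upwards [hpos] with ω ⟨q1, q2, _⟩
    simp only [Function.comp_def]
    positivity
  have hid : ∀ {r : ℝ}, 0 < r → ∀ k, IntegrableOn (fun t => t * erl k r t) (Ioi 0) :=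
    fun {r} hr k => by
    simp_rw [id_mul_erl]
    exact (integrableOn_erl (k + 1) hr).const_mul _
  have iA := (integral_erlang_conv_erlang n (inv_pos.2 ha) (inv_pos.2 hb) hxy measurable_id'
    (hid (inv_pos.2 ha)) (hid (inv_pos.2 hb))).1
  have iX := integrable_id_erlang n one_pos
  have iprod := (iA.mul_prod iX).const_mul (S.η * S.θ / S.d₂ ^ S.τ)
  set ν := erlang n (S.ρ₁ / S.d₁ ^ S.τ)⁻¹ ∗ erlang n (S.ρI / S.dI ^ S.τ)⁻¹ with hν
  -- The bound `log (1 + z) ≤ z` reduces integrability to that of a product of independent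
  -- integrable variables.
  have ilog : Integrable (fun p : ℝ × ℝ => Real.log (1 + S.η * S.θ / S.d₂ ^ S.τ * p.1 * p.2))
      (ν.prod (erlang n 1)) := by
    refine iprod.mono' (Measurable.aestronglyMeasurable (by fun_prop)) ?_
    have e1 : ∀ᵐ p ∂ν.prod (erlang n 1), 0 < p.1 :=
      Measure.quasiMeasurePreserving_fst.ae hA0
    have e2 : ∀ᵐ p ∂ν.prod (erlang n 1), 0 < p.2 :=
      Measure.quasiMeasurePreserving_snd.ae (ae_erlang_pos n 1)
    filter_upwards [e1, e2] with p hp1 hp2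
    have hcp : 0 ≤ S.η * S.θ / S.d₂ ^ S.τ * p.1 := by positivity
    rw [Real.norm_of_nonneg (log_one_add_mul_nonneg hcp hp2.le), ← mul_assoc]
    exact log_one_add_mul_le hcp hp2.le
  refine ⟨integrable_comp_of_hasLaw hl ilog, ?_⟩
  have hint : ∫ ω, Real.log (1 + S.gamma₂ (h₁ ω) (hI ω) (h₂ ω)) ∂μ =
      ∫ p : ℝ × ℝ, Real.log (1 + S.η * S.θ / S.d₂ ^ S.τ * p.1 * p.2) ∂ν.prod (erlang n 1) :=
    hl.integral_comp ilog.aestronglyMeasurable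
  rw [integral_prod _ ilog, integral_log_one_add_erlang_conv_erlang n hc (inv_pos.2 ha)
    (inv_pos.2 hb) hxy hA0] at hint
  rw [inv_div, inv_div, inv_div] at hint
  have hα : 0 < S.d₁ ^ S.τ / S.ρ₁ := by rw [← inv_div]; exact inv_pos.2 ha
  have hβ : 0 < S.dI ^ S.τ / S.ρI := by rw [← inv_div]; exact inv_pos.2 hb
  rw [ergodicCapacity, Params.capFormula₂, capSum₂_eq hS _ hα, capSum₂_eq hS _ hβ]
  simp_rw [Real.logb]
  rw [integral_div, hint, ← Complex.ofReal_add, ← Complex.ofReal_mul]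
  congr 1
  rw [div_pow, div_pow]
  field_simp

/-! ### The upper bound -/

lemma IsRayleigh.ergodicCapacity_gammaZF_le [IsProbabilityMeasure μ] (h : IsRayleigh μ h₁ hI h₂)
    (hN : 1 < N) (hS : S.Valid) (hne : S.ρ₁ / S.d₁ ^ S.τ ≠ S.ρI / S.dI ^ S.τ) :
    Integrable (fun ω => Real.log (1 + S.gammaZF (h₁ ω) (hI ω) (h₂ ω))) μ ∧
      ergodicCapacity μ (fun ω => S.gammaZF (h₁ ω) (hI ω) (h₂ ω)) ≤ S.capUpperBound N := by
  obtain ⟨i1, c1⟩ := h.integral_log_one_add_gammaZF₁ hN hS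
  obtain ⟨i2, c2⟩ := h.integral_log_one_add_gamma₂ hN hS hne
  obtain ⟨j1, l1⟩ := h.integral_log_gammaZF₁ hN hS
  obtain ⟨j2, l2⟩ := h.integral_log_gamma₂ hN hS hne
  obtain ⟨ha, hb, hc, hd⟩ := hS.link_pos
  have hpos : ∀ᵐ ω ∂μ, 0 < S.gammaZF₁ (h₁ ω) (hI ω) ∧ 0 < S.gamma₂ (h₁ ω) (hI ω) (h₂ ω) ∧
      S.gammaZF (h₁ ω) (hI ω) (h₂ ω) =
        S.gammaZF₁ (h₁ ω) (hI ω) * S.gamma₂ (h₁ ω) (hI ω) (h₂ ω) /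
          (1 + S.gammaZF₁ (h₁ ω) (hI ω) + S.gamma₂ (h₁ ω) (hI ω) (h₂ ω)) := by
    filter_upwards [h.ae_pos hN] with ω ⟨q1, q2, q3, q4⟩
    have hI0 : hI ω ≠ 0 := by intro h0; rw [h0] at q2; simp [normSq] at q2
    refine ⟨mul_pos q4 hd, ?_, Params.gammaZF_eq hS hI0 q4 q3⟩
    rw [gamma₂_eq]
    positivity
  set X : Ω → ℝ := fun ω => S.gammaZF₁ (h₁ ω) (hI ω)
  set Y : Ω → ℝ := fun ω => S.gamma₂ (h₁ ω) (hI ω) (h₂ ω)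
  -- Measurability is recovered from the integrable logarithms, since `X = exp (log X)` and `Y = exp
  -- (log Y)` almost everywhere.
  have hm1 : AEStronglyMeasurable (fun ω => Real.log (1 + X ω + Y ω)) μ := by
    have m1 : AEMeasurable (fun ω => Real.exp (Real.log (X ω))) μ :=
      j1.aestronglyMeasurable.aemeasurable.exp
    have m2 : AEMeasurable (fun ω => Real.exp (Real.log (Y ω))) μ :=
      j2.aestronglyMeasurable.aemeasurable.exp
    refine (((m1.const_add 1).add m2).log.congr ?_).aestronglyMeasurable
    filter_upwards [hpos] with ω ⟨q1, q2, _⟩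
    simp only [Pi.add_apply]
    rw [Real.exp_log q1, Real.exp_log q2]
  -- For positive `X` and `Y`, `1 + X + Y ≤ (1 + X) * (1 + Y)`, so the logarithm is dominated by the
  -- two integrable ones.
  have iXY : Integrable (fun ω => Real.log (1 + X ω + Y ω)) μ := by
    refine (i1.add i2).mono' hm1 ?_
    filter_upwards [hpos] with ω ⟨q1, q2, _⟩
    have q1' : 0 < X ω := q1
    have q2' : 0 < Y ω := q2
    rw [Real.norm_of_nonneg (Real.log_nonneg (by linarith)), Pi.add_apply,
      ← Real.log_mul (by positivity) (by positivity)]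
    exact Real.log_le_log (by positivity) (by nlinarith [mul_pos q1' q2'])
  have i12 : Integrable (fun ω => Real.log (1 + X ω) + Real.log (1 + Y ω)) μ := i1.add i2
  have hlog : (fun ω => Real.log (1 + S.gammaZF (h₁ ω) (hI ω) (h₂ ω))) =ᵐ[μ] fun ω =>
      Real.log (1 + X ω) + Real.log (1 + Y ω) - Real.log (1 + X ω + Y ω) := by
    filter_upwards [hpos] with ω ⟨q1, q2, q3⟩
    have q1' : 0 < X ω := q1
    have q2' : 0 < Y ω := q2
    rw [q3, one_add_mul_div_one_add_add q1.le q2.le, Real.log_div (by positivity) (by positivity),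
      Real.log_mul (by positivity) (by positivity)]
  refine ⟨(i12.sub iXY).congr hlog.symm, ?_⟩
  have hJ := log_one_add_exp_integral_le (hpos.mono fun _ hq => hq.1)
    (hpos.mono fun _ hq => hq.2.1) j1 j2 iXY
  rw [l1, l2] at hJ
  -- The Meijer sums are complex by definition; equality with a capacity shows that the closed form
  -- is real.
  have c2' : ergodicCapacity μ Y = (S.capFormula₂ N).re := by rw [← c2, Complex.ofReal_re]
  have h2 : 0 < Real.log 2 := Real.log_pos one_lt_two
  have hcap : ∀ Z : Ω → ℝ, ergodicCapacity μ Z =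
      1 / 2 * ((∫ ω, Real.log (1 + Z ω) ∂μ) / Real.log 2) := fun Z => by
    rw [ergodicCapacity]; simp_rw [Real.logb]; rw [integral_div]
  rw [Params.capUpperBound, ← c1, ← c2', hcap, hcap, hcap, integral_congr_ae hlog,
    integral_sub i12 iXY, integral_add i1 i2, Real.logb, sub_div, add_div]
  have := div_le_div_of_nonneg_right hJ h2.le
  linarith

end Hops

end Relay

end

/-! ### Assembly of the theorem -/

theorem theorem9 {Ω : Type*} [MeasurableSpace Ω] (μ : Measure Ω) [IsProbabilityMeasure μ]
    (N : ℕ) (hN : 1 < N) (S : Relay.Params) (hS : S.Valid)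
    (hne : S.ρ₁ / S.d₁ ^ S.τ ≠ S.ρI / S.dI ^ S.τ)
    (h₁ hI h₂ : Ω → Fin N → ℂ) (hch : Relay.IsRayleigh μ h₁ hI h₂) :
    -- all the expectations exist
    (Integrable (fun ω => Real.logb 2 (1 + S.gammaZF (h₁ ω) (hI ω) (h₂ ω))) μ ∧
      Integrable (fun ω => Real.logb 2 (1 + S.gammaZF₁ (h₁ ω) (hI ω))) μ ∧
      Integrable (fun ω => Real.logb 2 (1 + S.gamma₂ (h₁ ω) (hI ω) (h₂ ω))) μ ∧
      Integrable (fun ω => Real.log (S.gammaZF₁ (h₁ ω) (hI ω))) μ ∧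
      Integrable (fun ω => Real.log (S.gamma₂ (h₁ ω) (hI ω) (h₂ ω))) μ) ∧
    -- the closed forms of the terms of the bound
    Relay.ergodicCapacity μ (fun ω => S.gammaZF₁ (h₁ ω) (hI ω)) = S.capFormula₁ N ∧
    ((Relay.ergodicCapacity μ (fun ω => S.gamma₂ (h₁ ω) (hI ω) (h₂ ω)) : ℝ) : ℂ)
      = S.capFormula₂ N ∧
    ∫ ω, Real.log (S.gammaZF₁ (h₁ ω) (hI ω)) ∂μ = S.logFormula₁ N ∧
    ∫ ω, Real.log (S.gamma₂ (h₁ ω) (hI ω) (h₂ ω)) ∂μ = S.logFormula₂ N ∧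
    -- the upper bound
    Relay.ergodicCapacity μ (fun ω => S.gammaZF (h₁ ω) (hI ω) (h₂ ω)) ≤ S.capUpperBound N := by
  obtain ⟨i1, c1⟩ := hch.integral_log_one_add_gammaZF₁ hN hS
  obtain ⟨i2, c2⟩ := hch.integral_log_one_add_gamma₂ hN hS hne
  obtain ⟨j1, l1⟩ := hch.integral_log_gammaZF₁ hN hS
  obtain ⟨j2, l2⟩ := hch.integral_log_gamma₂ hN hS hne
  obtain ⟨i, hle⟩ := hch.ergodicCapacity_gammaZF_le hN hS hne
  exact ⟨⟨i.div_const _, i1.div_const _, i2.div_const _, j1, j2⟩, c1, c2, l1, l2, hle⟩
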